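/- Let $\Sigma$ be a finite alphabet. Call $L\subseteq\Sigma^*$ a DCFL if it is accepted by final state by some deterministic pushdown automaton ($\varepsilon$-moves allowed). Let $\Gamma_{\mathsf{REG}}(\mathsf{DCFL})$ (the regular closure) be the class of all languages over $\Sigma$ for which there are a regular expression $R$ over an alphabet $\{a_1,\dots,a_m\}$ and DCFLs $L_{a_1},\dots,L_{a_m}\subseteq\Sigma^*$ such that the expression obtained from $R$ by replacing each $a_i$ by $L_{a_i}$ describes the language. For a class $\mathscr L$ of languages over $\Sigma$, let $\Gamma_{\mathsf{Bool}}(\mathscr L)$ (the Boolean closure) be the least class that contains $\mathscr L$ and is closed under union, intersection and complement in $\Sigma^*$. A RAM has registers $0,1,2,\dots$ holding natural numbers, all initially $0$, and a one-way read-only input tape; its program is a finite list of the instructions load, store, add, subtract (truncated at $0$), read, jump, jump if the accumulator (register $0$) is zero, jump if it is positive, halt and accept, halt and reject; operands are literals, direct or indirect addresses. Multiplication and division are not available, and each instruction takes one unit of time. The letters of an input word are given as positive integers under a fixed injective coding of $\Sigma$; reading past the end of the input gives $0$. **Corollary.** For each $L\in\Gamma_{\mathsf{Bool}}(\Gamma_{\mathsf{REG}}(\mathsf{DCFL}))$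 (and each injective coding of $\Sigma$ by positive integers) there exists a RAM program $M$ that decides whether $w\in L$ in time $O(|w|)$, and moreover such that all numbers held in registers during the computation are $O(|w|)$. That is, there is a constant $c$ such that for every $w\in\Sigma^*$ the program $M$ halts on $w$ after at most $c(|w|+1)$ steps, accepting if $w\in L$ and rejecting if $w\notin L$, and no register ever holds a number exceeding $c(|w|+1)$. In particular, every language in the regular closure of the DCFLs is recognizable in linear time. -/

import Mathlib

/-! ## Deterministic context-free languages -/

/-- A deterministic pushdown automaton over the input alphabet `A`, with states `Q` and pushdown
symbols `G`. `δ q (some a) Z` is the move that reads the letter `a`, `δ q none Z` is the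
`ε`-move; a move replaces the top symbol `Z` by a word (its first letter becomes the new top).
Determinism: there is at most one move for each argument, and if an `ε`-move is available for
`(q, Z)` then no letter can be read there. -/
structure DPDA (A : Type*) (Q G : Type) where
  δ : Q → Option A → G → Option (Q × List G)
  start : Q
  bottom : G
  final : Set Q
  deterministic : ∀ q Z a, (δ q none Z).isSome → δ q (some a) Z = none

namespace DPDA

/-- An instantaneous description: current state, unread input, pushdown contents (top first). -/
abbrev ID (A : Type*) (Q G : Type) := Q × List A × List G

variable {A : Type*} {Q G : Type}

/-- One move of the automaton. It has no move when the pushdown is empty. -/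
inductive Step (M : DPDA A Q G) : ID A Q G → ID A Q G → Prop
  | read {q p : Q} {a : A} {w : List A} {Z : G} {γ β : List G} :
      M.δ q (some a) Z = some (p, β) → Step M (q, a :: w, Z :: γ) (p, w, β ++ γ)
  | eps {q p : Q} {w : List A} {Z : G} {γ β : List G} :
      M.δ q none Z = some (p, β) → Step M (q, w, Z :: γ) (p, w, β ++ γ)

/-- The language accepted by final state. -/
def language (M : DPDA A Q G) : Language A :=
  {w | ∃ p ∈ M.final, ∃ γ : List G,
    Relation.ReflTransGen M.Step (M.start, w, [M.bottom]) (p, [], γ)}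

end DPDA

/-- The class of deterministic context-free languages over `A`. -/
def DCFL (A : Type*) : Set (Language A) :=
  {L | ∃ (Q G : Type) (_ : Finite Q) (_ : Finite G) (M : DPDA A Q G), M.language = L}

/-! ## Regular closure and Boolean closure -/

/-- The language described by the expression obtained from the regular expression `R` by replacing
each letter `b` by the language `S b`. -/
def RegularExpression.substLanguage {A B : Type*} (S : B → Language A) :
    RegularExpression B → Language A
  | .zero => 0
  | .epsilon => 1
  | .char b => S b
  | .plus P R => P.substLanguage S + R.substLanguage S
  | .comp P R => P.substLanguage S * R.substLanguage S
  | .star P => KStar.kstar (P.substLanguage S)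

/-- The regular closure of a class `C` of languages: all languages described by a regular
expression over a finite alphabet whose letters are replaced by languages from `C`. -/
def RegClosure {A : Type*} (C : Set (Language A)) : Set (Language A) :=
  {L | ∃ (m : ℕ) (R : RegularExpression (Fin m)) (S : Fin m → Language A),
    (∀ i, S i ∈ C) ∧ R.substLanguage S = L}

/-- The Boolean closure of a class `C`: the least class containing `C` and closed under union,
intersection and complement (with respect to the set of all words over `A`). -/
inductive BoolClosure {A : Type*} (C : Set (Language A)) : Language A → Prop
  | base {L : Language A} : L ∈ C → BoolClosure C L
  | union {L K : Language A} : BoolClosure C L → BoolClosure C K → BoolClosure C (L ⊔ K)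
  | inter {L K : Language A} : BoolClosure C L → BoolClosure C K → BoolClosure C (L ⊓ K)
  | compl {L : Language A} : BoolClosure C L → BoolClosure C Lᶜ

/-! ## Random access machines -/

namespace RAM

/-- A register address: register `i`, or the register whose number is stored in register `i`. -/
inductive Addr
  | reg (i : ℕ)
  | ind (i : ℕ)

/-- An operand: a literal, or the contents of an addressed register. -/
inductive Operand
  | lit (k : ℕ)
  | at (d : Addr)

/-- The instructions of a RAM with addition and subtraction and without multiplication and
division. Register `0` is the accumulator. -/
inductive Instr
  /-- accumulator := operand -/
  | load (a : Operand)
  /-- addressed register := accumulator -/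
  | store (d : Addr)
  /-- accumulator := accumulator + operand -/
  | add (a : Operand)
  /-- accumulator := max (accumulator - operand) 0 -/
  | sub (a : Operand)
  /-- addressed register := next number on the input tape (`0` once the input is exhausted) -/
  | read (d : Addr)
  /-- unconditional jump -/
  | jump (l : ℕ)
  /-- jump if the accumulator is `0` -/
  | jzero (l : ℕ)
  /-- jump if the accumulator is positive -/
  | jgtz (l : ℕ)
  /-- halt and accept -/
  | accept
  /-- halt and reject -/
  | reject

/-- A program is a finite list of instructions, labelled `0, 1, 2, …`. -/
abbrev Program := List Instr

/-- A configuration: location counter, contents of the registers, unread part of the input. -/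
structure Config where
  pc : ℕ
  mem : ℕ → ℕ
  input : List ℕ

/-- The number of the register that `d` refers to. -/
def Addr.target (mem : ℕ → ℕ) : Addr → ℕ
  | .reg i => i
  | .ind i => mem i

/-- The value of an operand. -/
def Operand.value (mem : ℕ → ℕ) : Operand → ℕ
  | .lit k => k
  | .at d => mem (d.target mem)

/-- The effect of one instruction; the halting instructions leave the configuration unchanged. -/
def exec (s : Config) : Instr → Config
  | .load a => ⟨s.pc + 1, Function.update s.mem 0 (a.value s.mem), s.input⟩
  | .store d => ⟨s.pc + 1, Function.update s.mem (d.target s.mem) (s.mem 0), s.input⟩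
  | .add a => ⟨s.pc + 1, Function.update s.mem 0 (s.mem 0 + a.value s.mem), s.input⟩
  | .sub a => ⟨s.pc + 1, Function.update s.mem 0 (s.mem 0 - a.value s.mem), s.input⟩
  | .read d => ⟨s.pc + 1, Function.update s.mem (d.target s.mem) (s.input.headD 0), s.input.tail⟩
  | .jump l => ⟨l, s.mem, s.input⟩
  | .jzero l => ⟨if s.mem 0 = 0 then l else s.pc + 1, s.mem, s.input⟩
  | .jgtz l => ⟨if 0 < s.mem 0 then l else s.pc + 1, s.mem, s.input⟩
  | .accept => s
  | .reject => s

/-- One step of a program. Nothing happens if there is no instruction at the location counter. -/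
def step (P : Program) (s : Config) : Config :=
  match P[s.pc]? with
  | none => s
  | some i => exec s i

/-- The configuration after `t` steps on the input `x`. Initially all registers contain `0`. -/
def run (P : Program) (x : List ℕ) (t : ℕ) : Config :=
  (step P)^[t] ⟨0, fun _ => 0, x⟩

/-- The program stands at an accepting halt instruction after at most `t` steps. -/
def AcceptsWithin (P : Program) (x : List ℕ) (t : ℕ) : Prop :=
  ∃ s ≤ t, P[(run P x s).pc]? = some .accept

/-- The program stands at a rejecting halt instruction after at most `t` steps. -/
def RejectsWithin (P : Program) (x : List ℕ) (t : ℕ) : Prop :=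
  ∃ s ≤ t, P[(run P x s).pc]? = some .reject

/-- The program `P` decides `L` in time `O(|w|)`, where the letters of the input word are coded by
`code`. Every instruction has unit cost; this is kept honest by the requirement that all numbers
occurring in registers (in particular, all computed addresses) are `O(|w|)`, so that
`O(log |w|)`-bit words suffice. -/
def DecidesInLinearTime {A : Type*} (code : A → ℕ) (P : Program) (L : Language A) : Prop :=
  ∃ c : ℕ, ∀ w : List A,
    (w ∈ L → AcceptsWithin P (w.map code) (c * (w.length + 1))) ∧
    (w ∉ L → RejectsWithin P (w.map code) (c * (w.length + 1))) ∧
    ∀ t i, (run P (w.map code) t).mem i ≤ c * (w.length + 1)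

end RAM

/-! Membership of `w` is decided by one dynamic program over the suffixes of `w`, treated from right
to left, with boundedly many table entries per position and constant work for each.

Replace the regular expression by a finite automaton whose edges are labelled by DPDAs
(`RegularExpression.exists_segmentPath`). Whether this automaton accepts the suffix at `i` from a
state `x` is one bit. The difficulty is an edge: the word consumed by its DPDA may end at linearly
many positions, and trying them all costs quadratic time. Instead, one asks whether the run of the
DPDA on the suffix meets a final state at some position from which the target state accepts. This
too is a single bit (`hit`), and it obeys a recursion on the pushdown: either the run succeeds
before the top symbol is popped, or it pops that symbol and succeeds afterwards. The second case
needs the position and the state at the moment of popping. By determinism there is at most one such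
position (`DPDA.eq_of_steps_to_empty`), so one pointer per state suffices (`pop`), and the recursion
follows it in one step. Only pushdown words up to a fixed length are needed, because every move
writes a bounded word.

The abstract form of this recursion is a functional pointer system. Its rules look only at the
current row, the next row, or a row reached through a known pointer, hence never to the left. Rules
within a row may be cyclic because of `ε`-moves; values are then least fixed points, reached after
boundedly many rounds over all rules (`tabulate_eq_iff`). Boolean operations affect only the final
decision at position `0`.

On the RAM, a table entry is stored as the address of the row it points to, so that following a
pointer is an indirect access after the addition of a constant, without multiplication. The program
adds only literals; hence its numbers grow at most linearly with time, and the linear time bound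
also bounds the registers. -/

/-! ## Pointer systems -/

/-- A rule of a pointer system over the cells `C`: a guard, the cell that receives a value, and the
source of that value. The guard `none` is void, `some none` asks for the end of the word, and
`some (some a)` reads the letter `a`. The source `none` is the position reached, `some (e, none)` is
the value of the cell `e` there, and `some (e, some f)` is the value of the cell `f` at the position
that `e` points to. -/
abbrev PointerRule (A : Type*) (C : Type) := Option (Option A) × C × Option (C × Option C)

namespace PointerRule

variable {A : Type*} {C D : Type}

/-- The guard `g` is satisfied at position `i` of `w`, and leads to position `k`. -/
def Guard (w : List A) : Option (Option A) → ℕ → ℕ → Prop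
  | none, i, k => k = i ∧ i ≤ w.length
  | some none, i, k => k = i ∧ i = w.length
  | some (some a), i, k => w[i]? = some a ∧ k = i + 1

theorem Guard.le {w : List A} {g : Option (Option A)} {i k : ℕ} (h : Guard w g i k) :
    i ≤ k ∧ k ≤ w.length := by
  rcases g with _ | _ | a
  · obtain ⟨rfl, h⟩ := h; exact ⟨le_rfl, h⟩
  · obtain ⟨rfl, h⟩ := h; exact ⟨le_rfl, h.le⟩
  · obtain ⟨h, rfl⟩ := h
    obtain ⟨h, -⟩ := List.getElem?_eq_some_iff.1 h
    exact ⟨by omega, h⟩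

/-- `Derives R w i c j`: by the rules `R`, the cell `c` at position `i` of `w` points to `j`. -/
inductive Derives (R : Set (PointerRule A C)) (w : List A) : ℕ → C → ℕ → Prop
  | here {g c i k} : (g, c, none) ∈ R → Guard w g i k → Derives R w i c k
  | copy {g c e i k j} : (g, c, some (e, none)) ∈ R → Guard w g i k → Derives R w k e j →
      Derives R w i c j
  | via {g c e f i k l j} : (g, c, some (e, some f)) ∈ R → Guard w g i k → Derives R w k e l →
      Derives R w l f j → Derives R w i c j

/-- Guards and pointers never lead to the left. This is what permits an evaluation from right to
left. -/
theorem Derives.le {R : Set (PointerRule A C)} {w : List A} {i j : ℕ} {c : C}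
    (h : Derives R w i c j) : i ≤ j ∧ j ≤ w.length := by
  induction h with
  | here _ hg => exact hg.le
  | copy _ hg _ ih => exact ⟨hg.le.1.trans ih.1, ih.2⟩
  | via _ hg _ _ ih ih' => exact ⟨hg.le.1.trans (ih.1.trans ih'.1), ih'.2⟩

/-- Renaming the cells of a rule. -/
def map (f : C → D) (r : PointerRule A C) : PointerRule A D :=
  (r.1, f r.2.1, r.2.2.map fun s => (f s.1, s.2.map f))

/-- By `hT`, rules of `T` outside the image of `R` never give a value to a renamed cell, and the
sources of rules in the image are renamed cells again. Hence a derivation for a renamed cell never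
leaves the image. -/
theorem derives_map {f : C → D} (hf : Function.Injective f) {R : Set (PointerRule A C)}
    {T : Set (PointerRule A D)} (hR : map f '' R ⊆ T)
    (hT : ∀ r ∈ T, r.2.1 ∈ Set.range f → r ∈ map f '' R) {w : List A} {i j : ℕ} {c : C} :
    Derives T w i (f c) j ↔ Derives R w i c j := by
  constructor
  · generalize hd : f c = d
    intro h
    induction h generalizing c with
    | here hr hg =>
      obtain ⟨⟨g, c', s⟩, hr', he⟩ := hT _ hr ⟨c, hd⟩
      obtain _ | s := s
      · simp only [map, Option.map_none, Prod.mk.injEq, and_true] at he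
        obtain ⟨rfl, he⟩ := he
        obtain rfl := hf (he.trans hd.symm)
        exact .here hr' hg
      · simp [map] at he
    | copy hr hg _ ih =>
      obtain ⟨⟨g, c', s⟩, hr', he⟩ := hT _ hr ⟨c, hd⟩
      obtain _ | ⟨e, _ | e'⟩ := s
      · simp [map] at he
      · simp only [map, Option.map_some, Option.map_none, Prod.mk.injEq, Option.some.injEq,
          and_true] at he
        obtain ⟨rfl, he, he'⟩ := he
        obtain rfl := hf (he.trans hd.symm)
        exact .copy hr' hg (ih he')
      · simp [map] at he
    | via hr hg _ _ ih ih' =>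
      obtain ⟨⟨g, c', s⟩, hr', he⟩ := hT _ hr ⟨c, hd⟩
      obtain _ | ⟨e, _ | e'⟩ := s
      · simp [map] at he
      · simp [map] at he
      · simp only [map, Option.map_some, Prod.mk.injEq, Option.some.injEq] at he
        obtain ⟨rfl, he, he', he''⟩ := he
        obtain rfl := hf (he.trans hd.symm)
        exact .via hr' hg (ih he') (ih' he'')
  · intro h
    induction h with
    | here hr hg => exact .here (hR ⟨_, hr, rfl⟩) hg
    | copy hr hg _ ih => exact .copy (hR ⟨_, hr, rfl⟩) hg ih
    | via hr hg _ _ ih ih' => exact .via (hR ⟨_, hr, rfl⟩) hg ih ih'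

/-- The rules determine the value of each cell. -/
def Functional (R : Set (PointerRule A C)) : Prop :=
  ∀ w i c j k, Derives R w i c j → Derives R w i c k → j = k

end PointerRule

open PointerRule

/-- Membership of `w` in `L` is determined by the set of the cells of a functional pointer system
that have a value at the beginning of `w`. -/
def PointerRecognizable {A : Type*} (L : Language A) : Prop :=
  ∃ (C : Type) (_ : Finite C) (R : Set (PointerRule A C)) (Φ : Set (Set C)),
    Functional R ∧ ∀ w, w ∈ L ↔ {c | ∃ j, Derives R w 0 c j} ∈ Φ

namespace PointerRecognizable

variable {A : Type*} {L K : Language A}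

theorem compl (h : PointerRecognizable L) : PointerRecognizable Lᶜ := by
  obtain ⟨C, hC, R, Φ, hR, hL⟩ := h
  exact ⟨C, hC, R, Φᶜ, hR, fun w => not_congr (hL w)⟩

/-- The two systems stand side by side on the disjoint sum of the cells and do not interact. -/
theorem sup (h : PointerRecognizable L) (h' : PointerRecognizable K) :
    PointerRecognizable (L ⊔ K) := by
  obtain ⟨C, hC, R, Φ, hR, hL⟩ := h
  obtain ⟨C', hC', R', Φ', hR', hK⟩ := h'
  have hl : ∀ w i j (c : C), Derives (map Sum.inl '' R ∪ map Sum.inr '' R') w i (Sum.inl c) j ↔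
      Derives R w i c j := fun w i j c => by
    refine derives_map Sum.inl_injective Set.subset_union_left ?_
    rintro _ (h | ⟨r, -, rfl⟩) hc
    · exact h
    · simp [map] at hc
  have hr : ∀ w i j (c : C'), Derives (map Sum.inl '' R ∪ map Sum.inr '' R') w i (Sum.inr c) j ↔
      Derives R' w i c j := fun w i j c => by
    refine derives_map Sum.inr_injective Set.subset_union_right ?_
    rintro _ (⟨r, -, rfl⟩ | h) hc
    · simp [map] at hc
    · exact h
  refine ⟨C ⊕ C', inferInstance, map Sum.inl '' R ∪ map Sum.inr '' R',
    {s | Sum.inl ⁻¹' s ∈ Φ ∨ Sum.inr ⁻¹' s ∈ Φ'}, ?_, fun w => ?_⟩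
  · rintro w i (c | c) j k hj hk
    · exact hR w i c j k ((hl ..).1 hj) ((hl ..).1 hk)
    · exact hR' w i c j k ((hr ..).1 hj) ((hr ..).1 hk)
  · refine (or_congr (hL w) (hK w)).trans ?_
    simp only [Set.mem_ofPred_eq, Set.preimage_ofPred_eq, hl, hr]

theorem inf (h : PointerRecognizable L) (h' : PointerRecognizable K) :
    PointerRecognizable (L ⊓ K) := by
  simpa using (h.compl.sup h'.compl).compl

theorem of_boolClosure {S : Set (Language A)} (hS : ∀ L ∈ S, PointerRecognizable L)
    (h : BoolClosure S L) : PointerRecognizable L := by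
  induction h with
  | base h => exact hS _ h
  | union _ _ h h' => exact h.sup h'
  | inter _ _ h h' => exact h.inf h'
  | compl _ h => exact h.compl

end PointerRecognizable

/-! ## Automata whose transitions are labelled by languages -/

/-- `SegmentPath E S x w`: the automaton with transitions `E` goes from the state `x` to the exit
state `none` on the word `w`; a transition labelled `some b` consumes a word of `S b`, and one
labelled `none` consumes nothing. -/
inductive SegmentPath {A B : Type*} {N : Type} (E : N → Option B → Option N → Prop)
    (S : B → Language A) : Option N → List A → Prop
  | done : SegmentPath E S none []
  | eps {x y w} : E x none y → SegmentPath E S y w → SegmentPath E S (some x) w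
  | edge {x b y u v} : E x (some b) y → u ∈ S b → SegmentPath E S y v →
      SegmentPath E S (some x) (u ++ v)

namespace SegmentPath

variable {A B : Type*} {N M : Type} {E : N → Option B → Option N → Prop}
  {F : M → Option B → Option M → Prop} {S : B → Language A}

theorem none_iff {w : List A} : SegmentPath E S none w ↔ w = [] :=
  ⟨fun h => by cases h; rfl, fun h => h ▸ .done⟩

/-- Rename the states by `f`, and redirect the exit to `t`. -/
def redirect (f : N → M) (t : Option M) (y : Option N) : Option M := y.elim t (some ∘ f)

theorem redirect_append {f : N → M} {t : Option M}
    (hF : ∀ x o y, E x o y → F (f x) o (redirect f t y)) {y : Option N} {u v : List A}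
    (hu : SegmentPath E S y u) (hv : SegmentPath F S t v) :
    SegmentPath F S (redirect f t y) (u ++ v) := by
  induction hu with
  | done => exact hv
  | eps he _ ih => exact .eps (hF _ _ _ he) ih
  | edge he hu _ ih => rw [List.append_assoc]; exact .edge (hF _ _ _ he) hu ih

/-- By `hF`, a path can leave the copy of `E` only through the redirected exit; the word is split
where this happens. -/
theorem exists_of_redirect {f : N → M} {t : Option M}
    (hF : ∀ x o z, F (f x) o z → ∃ y, z = redirect f t y ∧ E x o y) {y : Option N} {w : List A}
    (h : SegmentPath F S (redirect f t y) w) :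
    ∃ u v, SegmentPath E S y u ∧ SegmentPath F S t v ∧ u ++ v = w := by
  generalize hz : redirect f t y = z at h
  induction h generalizing y with
  | done =>
    cases y with
    | none => exact ⟨[], [], .done, by rw [show t = none from hz]; exact .done, rfl⟩
    | some y => simp [redirect] at hz
  | @eps x z w he h ih =>
    cases y with
    | none => exact ⟨[], w, .done, by rw [show t = some x from hz]; exact .eps he h, rfl⟩
    | some y =>
      obtain rfl : f y = x := by simpa [redirect] using hz
      obtain ⟨y', rfl, hE⟩ := hF _ _ _ he
      obtain ⟨u, v, hu, hv, rfl⟩ := ih rfl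
      exact ⟨u, v, .eps hE hu, hv, rfl⟩
  | @edge x b z u' v' he hu' h ih =>
    cases y with
    | none =>
      exact ⟨[], u' ++ v', .done, by rw [show t = some x from hz]; exact .edge he hu' h, rfl⟩
    | some y =>
      obtain rfl : f y = x := by simpa [redirect] using hz
      obtain ⟨y', rfl, hE⟩ := hF _ _ _ he
      obtain ⟨u, v, hu, hv, rfl⟩ := ih rfl
      exact ⟨u' ++ u, v, .edge hE hu' hu, hv, List.append_assoc ..⟩

end SegmentPath

-- Thompson's construction. A sum receives a new state that branches into the two parts, a product
-- redirects the exit of the first factor to the start of the second, and a star receives a new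
-- state to which the exit of the body returns. The start may itself be the exit, which gives the
-- empty word.
open SegmentPath in
theorem RegularExpression.exists_segmentPath {A B : Type*} (S : B → Language A)
    (R : RegularExpression B) :
    ∃ (N : Type) (_ : Finite N) (E : N → Option B → Option N → Prop) (s : Option N),
      ∀ w, SegmentPath E S s w ↔ w ∈ R.substLanguage S := by
  induction R with
  | zero =>
    refine ⟨Unit, inferInstance, fun _ _ _ => False, some (), fun w => ⟨fun h => ?_, fun h => ?_⟩⟩
    · cases h <;> contradiction
    · exact absurd h (Language.notMem_zero w)
  | epsilon =>
    refine ⟨Unit, inferInstance, fun _ _ _ => False, none, fun w => ?_⟩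
    rw [none_iff]
    exact (Language.mem_one w).symm
  | char b =>
    refine ⟨Unit, inferInstance, fun _ o y => o = some b ∧ y = none, some (),
      fun w => ⟨fun h => ?_, fun h => ?_⟩⟩
    · cases h with
      | eps h => simp at h
      | edge h hu hv =>
        obtain ⟨h, rfl⟩ := h
        obtain rfl := Option.some.inj h
        rw [none_iff.1 hv, List.append_nil]
        exact hu
    · rw [← List.append_nil w]
      exact .edge ⟨rfl, rfl⟩ h .done
  | plus P Q ihP ihQ =>
    obtain ⟨N, hN, E, s, hP⟩ := ihP
    obtain ⟨M, hM, F, t, hQ⟩ := ihQ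
    let G : Option (N ⊕ M) → Option B → Option (Option (N ⊕ M)) → Prop
      | none, o, z => o = none ∧ (z = redirect (fun x => some (Sum.inl x)) none s ∨
          z = redirect (fun x => some (Sum.inr x)) none t)
      | some (Sum.inl x), o, z => ∃ y, z = redirect (fun x => some (Sum.inl x)) none y ∧ E x o y
      | some (Sum.inr x), o, z => ∃ y, z = redirect (fun x => some (Sum.inr x)) none y ∧ F x o y
    have hl : ∀ w, SegmentPath G S (redirect (fun x => some (Sum.inl x)) none s) w ↔
        w ∈ P.substLanguage S := fun w => by
      rw [← hP]
      refine ⟨fun h => ?_, fun h => ?_⟩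
      · obtain ⟨u, v, hu, hv, rfl⟩ := exists_of_redirect (fun x o z h => h) h
        rwa [none_iff.1 hv, List.append_nil]
      · simpa using redirect_append (F := G) (f := fun x => some (Sum.inl x)) (t := none)
          (fun x o y h => ⟨y, rfl, h⟩) h .done
    have hr : ∀ w, SegmentPath G S (redirect (fun x => some (Sum.inr x)) none t) w ↔
        w ∈ Q.substLanguage S := fun w => by
      rw [← hQ]
      refine ⟨fun h => ?_, fun h => ?_⟩
      · obtain ⟨u, v, hu, hv, rfl⟩ := exists_of_redirect (fun x o z h => h) h
        rwa [none_iff.1 hv, List.append_nil]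
      · simpa using redirect_append (F := G) (f := fun x => some (Sum.inr x)) (t := none)
          (fun x o y h => ⟨y, rfl, h⟩) h .done
    refine ⟨Option (N ⊕ M), inferInstance, G, some none, fun w => ⟨fun h => ?_, fun h => ?_⟩⟩
    · cases h with
      | eps h hw =>
        obtain ⟨-, rfl | rfl⟩ := h
        · exact Or.inl ((hl _).1 hw)
        · exact Or.inr ((hr _).1 hw)
      | edge h => exact absurd h.1 (by simp)
    · rcases h with h | h
      · exact .eps ⟨rfl, Or.inl rfl⟩ ((hl _).2 h)
      · exact .eps ⟨rfl, Or.inr rfl⟩ ((hr _).2 h)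
  | comp P Q ihP ihQ =>
    obtain ⟨N, hN, E, s, hP⟩ := ihP
    obtain ⟨M, hM, F, t, hQ⟩ := ihQ
    let t' : Option (N ⊕ M) := redirect Sum.inr none t
    let G : N ⊕ M → Option B → Option (N ⊕ M) → Prop
      | Sum.inl x, o, z => ∃ y, z = redirect Sum.inl t' y ∧ E x o y
      | Sum.inr x, o, z => ∃ y, z = redirect Sum.inr none y ∧ F x o y
    have hr : ∀ w, SegmentPath G S t' w ↔ w ∈ Q.substLanguage S := fun w => by
      rw [← hQ]
      refine ⟨fun h => ?_, fun h => ?_⟩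
      · obtain ⟨u, v, hu, hv, rfl⟩ := exists_of_redirect (fun x o z h => h) h
        rwa [none_iff.1 hv, List.append_nil]
      · simpa using redirect_append (F := G) (f := Sum.inr) (t := none)
          (fun x o y h => ⟨y, rfl, h⟩) h .done
    refine ⟨N ⊕ M, inferInstance, G, redirect Sum.inl t' s, fun w => ⟨fun h => ?_, fun h => ?_⟩⟩
    · obtain ⟨u, v, hu, hv, rfl⟩ := exists_of_redirect (fun x o z h => h) h
      exact Language.append_mem_mul ((hP u).1 hu) ((hr v).1 hv)
    · obtain ⟨u, hu, v, hv, rfl⟩ := Language.mem_mul.1 h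
      exact redirect_append (F := G) (f := Sum.inl) (t := t')
          (fun x o y h => ⟨y, rfl, h⟩) ((hP u).2 hu) ((hr v).2 hv)
  | star P ihP =>
    obtain ⟨N, hN, E, s, hP⟩ := ihP
    let G : Option N → Option B → Option (Option N) → Prop
      | none, o, z => o = none ∧ (z = none ∨ z = redirect some (some none) s)
      | some x, o, z => ∃ y, z = redirect some (some none) y ∧ E x o y
    refine ⟨Option N, inferInstance, G, some none, fun w => ⟨fun h => ?_, fun h => ?_⟩⟩
    -- The induction must also cover paths that begin inside an iteration: `u` completes the current
    -- iteration and `v` consists of the later ones.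
    · suffices H : ∀ z, SegmentPath G S z w → (z = none → w = []) ∧
          ∀ y, z = redirect some (some none) y → ∃ u v, SegmentPath E S y u ∧
            v ∈ KStar.kstar (P.substLanguage S) ∧ u ++ v = w by
        obtain ⟨u, v, hu, hv, rfl⟩ := (H _ h).2 none rfl
        rwa [none_iff.1 hu]
      clear h
      intro z h
      induction h with
      | done =>
        refine ⟨fun _ => rfl, fun y hy => ?_⟩
        cases y <;> simp [redirect] at hy
      | @eps x z w he h ih =>
        refine ⟨by simp, fun y hy => ?_⟩
        cases y with
        | none =>
          obtain rfl : x = none := by simpa [redirect] using hy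
          refine ⟨[], w, .done, ?_, rfl⟩
          obtain ⟨-, rfl | rfl⟩ := he
          · rw [ih.1 rfl]; exact Language.nil_mem_kstar _
          · obtain ⟨u, v, hu, hv, rfl⟩ := ih.2 s rfl
            rw [← Language.one_add_self_mul_kstar_eq_kstar]
            exact Or.inr (Language.append_mem_mul ((hP u).1 hu) hv)
        | some y =>
          obtain rfl : x = some y := by simpa [redirect] using hy
          obtain ⟨y', rfl, hE⟩ := he
          obtain ⟨u, v, hu, hv, rfl⟩ := ih.2 y' rfl
          exact ⟨u, v, .eps hE hu, hv, rfl⟩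
      | @edge x b z u' v' he hu' h ih =>
        refine ⟨by simp, fun y hy => ?_⟩
        cases y with
        | none =>
          obtain rfl : x = none := by simpa [redirect] using hy
          exact absurd he.1 (by simp)
        | some y =>
          obtain rfl : x = some y := by simpa [redirect] using hy
          obtain ⟨y', rfl, hE⟩ := he
          obtain ⟨u, v, hu, hv, rfl⟩ := ih.2 y' rfl
          exact ⟨u' ++ u, v, .edge hE hu' hu, hv, List.append_assoc ..⟩
    · obtain ⟨l, rfl, hl⟩ := Language.mem_kstar.1 h
      clear h
      induction l with
      | nil => exact .eps ⟨rfl, Or.inl rfl⟩ .done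
      | cons u l ih =>
        rw [List.forall_mem_cons] at hl
        exact .eps ⟨rfl, Or.inr rfl⟩ (redirect_append (F := G) (f := some) (t := some none)
          (fun x o y h => ⟨y, rfl, h⟩)
          ((hP u).2 hl.1) (ih hl.2))

/-! ## The regular closure of the deterministic context-free languages -/

namespace DPDA

variable {A : Type*} {Q G : Type} {M : DPDA A Q G}

theorem Step.right_unique : Relator.RightUnique M.Step := by
  rintro _ _ _ (@⟨q, p, a, w, Z, γ, β, h⟩ | @⟨q, p, w, Z, γ, β, h⟩) h'
  · cases h' with
    | read h' => rw [h] at h'; cases h'; rfl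
    | eps h' => rw [M.deterministic q Z a (by simp [h'])] at h; cases h
  · cases h' with
    | read h' => rw [M.deterministic _ _ _ (by rw [h]; rfl)] at h'; cases h'
    | eps h' => rw [h] at h'; cases h'; rfl

/-- Of two configurations on the same deterministic run, one leads to the other, and an empty
pushdown admits no move. This is the use of determinism that makes the `pop` cells single-valued. -/
theorem eq_of_steps_to_empty {x : ID A Q G} {q q' : Q} {u u' : List A}
    (h : Relation.ReflTransGen M.Step x (q, u, []))
    (h' : Relation.ReflTransGen M.Step x (q', u', [])) : (q, u) = (q', u') := by
  rcases h.total_of_right_unique Step.right_unique h' with h | h <;>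
    rcases h.cases_head with h | ⟨y, h, -⟩
  · cases h; rfl
  · cases h
  · cases h; rfl
  · cases h

theorem steps_append_stack {q p : Q} {u v : List A} {γ γ' : List G} (β : List G)
    (h : Relation.ReflTransGen M.Step (q, u, γ) (p, v, γ')) :
    Relation.ReflTransGen M.Step (q, u, γ ++ β) (p, v, γ' ++ β) := by
  refine h.lift (fun x : ID A Q G => (x.1, x.2.1, x.2.2 ++ β)) fun x y h => ?_
  cases h with
  | read h => simpa [Function.onFun] using Step.read (M := M) (w := _) (γ := _ ++ β) h
  | eps h => simpa [Function.onFun] using Step.eps (M := M) (γ := _ ++ β) h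

theorem steps_append_input {q p : Q} {u v : List A} {γ γ' : List G} (w : List A)
    (h : Relation.ReflTransGen M.Step (q, u, γ) (p, v, γ')) :
    Relation.ReflTransGen M.Step (q, u ++ w, γ) (p, v ++ w, γ') := by
  refine h.lift (fun x : ID A Q G => (x.1, x.2.1 ++ w, x.2.2)) fun x y h => ?_
  cases h with
  | read h => exact Step.read h
  | eps h => exact Step.eps h

theorem exists_steps_prefix {x y : ID A Q G} (h : Relation.ReflTransGen M.Step x y) :
    ∃ u, x.2.1 = u ++ y.2.1 ∧
      Relation.ReflTransGen M.Step (x.1, u, x.2.2) (y.1, [], y.2.2) := by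
  induction h using Relation.ReflTransGen.head_induction_on with
  | refl => exact ⟨[], rfl, .refl⟩
  | head h _ ih =>
    obtain ⟨u, hu, ih⟩ := ih
    cases h with
    | @read _ _ a _ _ _ _ h => exact ⟨a :: u, by simp at hu ⊢; exact hu, ih.head (.read h)⟩
    | eps h => exact ⟨u, hu, ih.head (.eps h)⟩

/-- This bound keeps the set of pushdown words that need cells finite. -/
theorem exists_length_bound [Finite A] [Finite Q] [Finite G] (M : DPDA A Q G) :
    ∃ n, ∀ q o Z p β, M.δ q o Z = some (p, β) → β.length ≤ n := by
  obtain ⟨n, hn⟩ := (Set.finite_range fun x : Q × Option A × G =>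
    ((M.δ x.1 x.2.1 x.2.2).elim 0 fun y => y.2.length)).bddAbove
  refine ⟨n, fun q o Z p β h => ?_⟩
  have := hn ⟨(q, o, Z), rfl⟩
  simpa [h] using this

end DPDA

/-! ### Runs of the component automata as a pointer system: soundness -/

/-- The cells of the pointer system for an automaton with states `N` whose transitions are labelled
by pushdown automata. `state s` has a value if the automaton accepts from `s` on. `pop k q γ r`
points to the position where the automaton `k`, started in the state `q` with the pushdown `γ`, has
emptied it in the state `r`. `hit k q γ t` has a value if it reaches a final state at a position
where `state t` has a value. -/
inductive ClosureCell {B : Type} (Q G : B → Type) (N : Type) (n : ℕ) : Type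
  | state (s : Option N)
  | pop (k : B) (q : Q k) (γ : List (G k)) (h : γ.length ≤ n) (r : Q k)
  | hit (k : B) (q : Q k) (γ : List (G k)) (h : γ.length ≤ n) (t : Option N)

namespace ClosureCell

open PointerRule

variable {A : Type*} {B : Type} {Q G : B → Type} {N : Type} {n : ℕ}

instance [Finite B] [∀ k, Finite (Q k)] [∀ k, Finite (G k)] [Finite N] :
    Finite (ClosureCell Q G N n) := by
  have : ∀ k, Finite {γ : List (G k) // γ.length ≤ n} := fun k => List.finite_length_le (G k) n
  refine Finite.of_surjective (α := Option N ⊕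
    (Σ k, Q k × {γ : List (G k) // γ.length ≤ n} × (Q k ⊕ Option N))) (fun
    | .inl s => state s
    | .inr ⟨k, q, γ, .inl r⟩ => pop k q γ γ.2 r
    | .inr ⟨k, q, γ, .inr t⟩ => hit k q γ γ.2 t) ?_
  rintro (s | ⟨k, q, γ, h, r⟩ | ⟨k, q, γ, h, t⟩)
  · exact ⟨.inl s, rfl⟩
  · exact ⟨.inr ⟨k, q, ⟨γ, h⟩, .inl r⟩, rfl⟩
  · exact ⟨.inr ⟨k, q, ⟨γ, h⟩, .inr t⟩, rfl⟩

/-- The rules for the cells of `ClosureCell`. -/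
inductive Rule (M : ∀ k, DPDA A (Q k) (G k)) (E : N → Option B → Option N → Prop) :
    PointerRule A (ClosureCell Q G N n) → Prop
  | exit : Rule M E (some none, state none, none)
  | eps {x y} : E x none y → Rule M E (none, state (some x), some (state y, none))
  | edge {x k y h} : E x (some k) y →
      Rule M E (none, state (some x), some (hit k (M k).start [(M k).bottom] h y, none))
  | popNil {k q h} : Rule M E (none, pop k q [] h q, none)
  | popMove {k q o Z p β h h' r} : (M k).δ q o Z = some (p, β) →
      Rule M E (o.map some, pop k q [Z] h r, some (pop k p β h' r, none))
  | popCons {k q Z γ h h' h'' r p} :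
      Rule M E (none, pop k q (Z :: γ) h r, some (pop k q [Z] h' p, some (pop k p γ h'' r)))
  | hitFinal {k q γ h t} : q ∈ (M k).final →
      Rule M E (none, hit k q γ h t, some (state t, none))
  | hitMove {k q o Z p β h h' t} : (M k).δ q o Z = some (p, β) →
      Rule M E (o.map some, hit k q [Z] h t, some (hit k p β h' t, none))
  | hitHead {k q Z γ h h' t} :
      Rule M E (none, hit k q (Z :: γ) h t, some (hit k q [Z] h' t, none))
  | hitTail {k q Z γ h h' h'' t p} :
      Rule M E (none, hit k q (Z :: γ) h t, some (pop k q [Z] h' p, some (hit k p γ h'' t)))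

variable {M : ∀ k, DPDA A (Q k) (G k)} {E : N → Option B → Option N → Prop} {w : List A}

theorem step_of_guard {Q G : Type} {M : DPDA A Q G} {q p : Q} {o : Option A} {Z : G}
    {β γ : List G} {i k : ℕ} (h : M.δ q o Z = some (p, β)) (hg : Guard w (o.map some) i k) :
    M.Step (q, w.drop i, Z :: γ) (p, w.drop k, β ++ γ) := by
  cases o with
  | none => obtain ⟨rfl, -⟩ := hg; exact .eps h
  | some a =>
    obtain ⟨ha, rfl⟩ := hg
    obtain ⟨hi, rfl⟩ := List.getElem?_eq_some_iff.1 ha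
    rw [List.drop_eq_getElem_cons hi]
    exact .read h

/-- What it means that the cell `c` has the value `j` at position `i`. -/
def Holds (M : ∀ k, DPDA A (Q k) (G k)) (E : N → Option B → Option N → Prop) (w : List A)
    (i : ℕ) (c : ClosureCell Q G N n) (j : ℕ) : Prop :=
  match c with
  | state x => j = w.length ∧ SegmentPath E (fun k => (M k).language) x (w.drop i)
  | pop k q γ _ r => Relation.ReflTransGen (M k).Step (q, w.drop i, γ) (r, w.drop j, [])
  | hit k q γ _ t => j = w.length ∧ ∃ f ∈ (M k).final, ∃ u γ',
      Relation.ReflTransGen (M k).Step (q, w.drop i, γ) (f, u, γ') ∧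
      SegmentPath E (fun k => (M k).language) t u

theorem holds_of_derives {i j : ℕ} {c : ClosureCell Q G N n}
    (h : Derives {r | Rule M E r} w i c j) : Holds M E w i c j := by
  induction h with
  | here hr hg =>
    cases hr with
    | exit =>
      obtain ⟨rfl, rfl⟩ := hg
      exact ⟨rfl, by rw [List.drop_length]; exact .done⟩
    | popNil => obtain ⟨rfl, -⟩ := hg; exact .refl
  | copy hr hg _ ih =>
    cases hr with
    | eps h => obtain ⟨rfl, -⟩ := hg; exact ⟨ih.1, .eps h ih.2⟩
    | edge h =>
      obtain ⟨rfl, -⟩ := hg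
      obtain ⟨hj, f, hf, u, γ, hs, ht⟩ := ih
      -- The run was made on the whole suffix; without the part left unread it shows that the
      -- consumed part is a word of the language.
      obtain ⟨v, hv, hs⟩ := DPDA.exists_steps_prefix hs
      exact ⟨hj, by rw [show List.drop _ w = _ from hv]; exact .edge h ⟨f, hf, _, hs⟩ ht⟩
    | popMove h =>
      have := step_of_guard (γ := []) h hg
      rw [List.append_nil] at this
      exact Relation.ReflTransGen.head this ih
    | hitFinal h => obtain ⟨rfl, -⟩ := hg; exact ⟨ih.1, _, h, _, _, .refl, ih.2⟩
    | hitMove h =>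
      have := step_of_guard (γ := []) h hg
      rw [List.append_nil] at this
      obtain ⟨hj, f, hf, u, γ, hs, ht⟩ := ih
      exact ⟨hj, f, hf, u, γ, hs.head this, ht⟩
    | hitHead =>
      obtain ⟨rfl, -⟩ := hg
      obtain ⟨hj, f, hf, u, γ, hs, ht⟩ := ih
      exact ⟨hj, f, hf, u, _, DPDA.steps_append_stack _ hs, ht⟩
  | via hr hg _ _ ih ih' =>
    cases hr with
    | popCons =>
      obtain ⟨rfl, -⟩ := hg
      exact (DPDA.steps_append_stack _ ih).trans ih'
    | hitTail =>
      obtain ⟨rfl, -⟩ := hg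
      obtain ⟨hj, f, hf, u, γ, hs, ht⟩ := ih'
      exact ⟨hj, f, hf, u, γ, (DPDA.steps_append_stack _ ih).trans hs, ht⟩

/-- The cells `state` and `hit` only ever take the value `w.length`, so they act as single bits; for
`pop` the reason is determinism. -/
theorem functional : Functional {r : PointerRule A (ClosureCell Q G N n) | Rule M E r} := by
  intro w i c j k hj hk
  have hj' := holds_of_derives hj
  have hk' := holds_of_derives hk
  cases c with
  | state s => exact hj'.1.trans hk'.1.symm
  | hit _ q γ h t => exact hj'.1.trans hk'.1.symm
  | pop _ q γ h r =>
    -- Equal suffixes determine the position only up to the end of the word; `Derives.le` excludes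
    -- the positions beyond it.
    have h := congrArg (fun x => x.2.length) (DPDA.eq_of_steps_to_empty hj' hk')
    have := hj.le
    have := hk.le
    simp only [List.length_drop] at h
    omega

/-! ### Completeness of the rules -/

/-- The pushdown automaton `k` can reach a final state at a position where `state t` has a value. -/
inductive Hits (M : ∀ k, DPDA A (Q k) (G k)) (E : N → Option B → Option N → Prop) (n : ℕ)
    (w : List A) (k : B) (t : Option N) : ℕ → Q k → List (G k) → Prop
  | final {i q γ} : q ∈ (M k).final →
      Derives {r : PointerRule A (ClosureCell Q G N n) | Rule M E r} w i (state t) w.length →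
      Hits M E n w k t i q γ
  | head {i q Z γ h} :
      Derives {r : PointerRule A (ClosureCell Q G N n) | Rule M E r} w i (hit k q [Z] h t)
        w.length → Hits M E n w k t i q (Z :: γ)
  | tail {i q Z γ h r l} :
      Derives {r : PointerRule A (ClosureCell Q G N n) | Rule M E r} w i (pop k q [Z] h r) l →
      Hits M E n w k t l r γ → Hits M E n w k t i q (Z :: γ)

/-- `Hits` allows pushdowns of any height, the cells only short ones. Peeling the symbols of `β` off
one by one, either success comes before `β` is used up, or the successive pops compose to a `pop` of
all of `β`. -/
theorem Hits.append {k : B} {t : Option N} {i : ℕ} {q : Q k} {β γ : List (G k)}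
    (hi : i ≤ w.length) (hβ : β.length ≤ n) (h : Hits M E n w k t i q (β ++ γ)) :
    Derives {r | Rule M E r} w i (hit k q β hβ t) w.length ∨
    ∃ r l, Derives {r | Rule M E r} w i (pop k q β hβ r) l ∧ Hits M E n w k t l r γ := by
  induction β generalizing i q with
  | nil => exact Or.inr ⟨q, i, .here .popNil ⟨rfl, hi⟩, h⟩
  | cons Z β ih =>
    cases h with
    | final hf h => exact Or.inl (.copy (.hitFinal hf) ⟨rfl, hi⟩ h)
    | head h => exact Or.inl (.copy .hitHead ⟨rfl, hi⟩ h)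
    | tail h h' =>
      rcases ih h.le.2 (Nat.le_of_succ_le hβ) h' with h'' | ⟨r, l, h'', h'''⟩
      · exact Or.inl (.via .hitTail ⟨rfl, hi⟩ h h'')
      · exact Or.inr ⟨r, l, .via .popCons ⟨rfl, hi⟩ h h'', h'''⟩

theorem Hits.derives {k : B} {t : Option N} {i : ℕ} {q : Q k} {γ : List (G k)}
    (hi : i ≤ w.length) (hγ : γ.length ≤ n) (h : Hits M E n w k t i q γ) :
    Derives {r | Rule M E r} w i (hit k q γ hγ t) w.length := by
  induction h with
  | final hf h => exact .copy (.hitFinal hf) ⟨rfl, hi⟩ h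
  | head h => exact .copy .hitHead ⟨rfl, hi⟩ h
  | tail h _ ih => exact .via .hitTail ⟨rfl, hi⟩ h (ih h.le.2 (Nat.le_of_succ_le hγ))

/-- `β` is what the move writes in place of `Z`. Success above `γ` thus becomes success above `γ`
from `Z`, and popping `β` becomes popping `Z`. The assumption `hn` provides the cells for `[Z]`. -/
theorem Hits.move (hn : 1 ≤ n) {k : B} {t : Option N} {i l : ℕ} {q p : Q k} {o : Option A}
    {Z : G k} {β γ : List (G k)} (hβ : β.length ≤ n) (h : (M k).δ q o Z = some (p, β))
    (hg : Guard w (o.map some) i l) (hh : Hits M E n w k t l p (β ++ γ)) :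
    Hits M E n w k t i q (Z :: γ) := by
  rcases hh.append hg.le.2 hβ with h' | ⟨r, j, h', h''⟩
  · exact .head (h := hn) (.copy (.hitMove h) hg h')
  · exact .tail (h := hn) (.copy (.popMove h) hg h') h''

/-- Induction backwards along the run, from the final configuration, with `Hits.move` at each move.
-/
theorem hits_of_steps (hn : 1 ≤ n)
    (hM : ∀ k q o Z p β, (M k).δ q o Z = some (p, β) → β.length ≤ n) {k : B} {t : Option N}
    {x y : DPDA.ID A (Q k) (G k)} (h : Relation.ReflTransGen (M k).Step x y)
    (hf : y.1 ∈ (M k).final)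
    (ht : ∀ i ≤ w.length, y.2.1 = w.drop i →
      Derives {r : PointerRule A (ClosureCell Q G N n) | Rule M E r} w i (state t) w.length)
    {i : ℕ} (hi : i ≤ w.length) (hx : x.2.1 = w.drop i) : Hits M E n w k t i x.1 x.2.2 := by
  induction h using Relation.ReflTransGen.head_induction_on generalizing i with
  | refl => exact .final hf (ht i hi hx)
  | head h _ ih =>
    cases h with
    | @read _ _ a u _ _ _ h =>
      replace hx : a :: u = w.drop i := hx
      have hlt : i < w.length := by
        by_contra hlt
        rw [List.drop_eq_nil_of_le (not_lt.1 hlt)] at hx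
        cases hx
      rw [List.drop_eq_getElem_cons hlt] at hx
      obtain ⟨rfl, rfl⟩ := List.cons.inj hx
      exact Hits.move hn (hM _ _ _ _ _ _ h) h ⟨List.getElem?_eq_getElem hlt, rfl⟩ (ih hlt rfl)
    | eps h => exact Hits.move hn (hM _ _ _ _ _ _ h) h ⟨rfl, hi⟩ (ih hi hx)

theorem derives_of_segmentPath (hn : 1 ≤ n)
    (hM : ∀ k q o Z p β, (M k).δ q o Z = some (p, β) → β.length ≤ n) {x : Option N}
    {u : List A} (h : SegmentPath E (fun k => (M k).language) x u) {i : ℕ} (hi : i ≤ w.length)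
    (hu : u = w.drop i) :
    Derives {r : PointerRule A (ClosureCell Q G N n) | Rule M E r} w i (state x) w.length := by
  induction h generalizing i with
  | done =>
    have := List.drop_eq_nil_iff.1 hu.symm
    obtain rfl : i = w.length := le_antisymm hi this
    exact .here .exit ⟨rfl, rfl⟩
  | eps h _ ih => exact .copy (.eps h) ⟨rfl, hi⟩ (ih hi hu)
  | @edge x k y u v h hu' _ ih =>
    obtain ⟨f, hf, γ, hs⟩ := hu'
    have := hits_of_steps (t := y) (w := w) (n := n) (E := E) hn hM
      (DPDA.steps_append_input v hs) hf (fun i hi h => ih hi (by simpa using h)) hi hu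
    exact .copy (.edge h) ⟨rfl, hi⟩ (this.derives hi hn)

end ClosureCell

theorem PointerRecognizable.of_regClosure {A : Type*} [Finite A] {L : Language A}
    (h : L ∈ RegClosure (DCFL A)) : PointerRecognizable L := by
  obtain ⟨m, R, S, hS, rfl⟩ := h
  choose Q G hQ hG M hM using hS
  obtain ⟨N, hN, E, s, hE⟩ := R.exists_segmentPath S
  choose b hb using fun k => (M k).exists_length_bound
  obtain ⟨n, hn⟩ := (Set.finite_range b).bddAbove
  -- The bound `n + 1` instead of `n` ensures that one-letter pushdowns have cells even if `n = 0`.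
  have hle : ∀ k q o Z p β, (M k).δ q o Z = some (p, β) → β.length ≤ n + 1 :=
    fun k q o Z p β h => (hb k q o Z p β h).trans ((hn ⟨k, rfl⟩).trans n.le_succ)
  refine ⟨ClosureCell Q G N (n + 1), inferInstance, {r | ClosureCell.Rule M E r},
    {s' | .state s ∈ s'}, ClosureCell.functional, fun w => ?_⟩
  rw [← hE, ← funext hM]
  refine ⟨fun h => ⟨_, ClosureCell.derives_of_segmentPath (Nat.le_add_left 1 n) hle h
    (Nat.zero_le _) (List.drop_zero).symm⟩, fun ⟨j, h⟩ => ?_⟩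
  have := (ClosureCell.holds_of_derives h).2
  rwa [List.drop_zero] at this

/-! ## Computing the values of a functional pointer system from right to left -/

namespace PointerRule

variable {A : Type*} {C : Type}

/-- A table of pointers: `0` at position `i` and cell `c` means that no value is known, and `j + 1`
that the value is `j`. -/
abbrev Table (C : Type) := ℕ → C → ℕ

/-- The entry that the source `s` of a rule yields at position `k`. -/
def sourceEntry (V : Table C) (k : ℕ) : Option (C × Option C) → ℕ
  | none => k + 1
  | some (e, none) => V k e
  | some (e, some f) => if V k e = 0 then 0 else V (V k e - 1) f

open Classical in
/-- The entry that a rule yields at position `i`. -/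
noncomputable def entry (w : List A) (V : Table C) (i : ℕ) : PointerRule A C → ℕ
  | (none, _, s) => sourceEntry V i s
  | (some none, _, s) => if i = w.length then sourceEntry V i s else 0
  | (some (some a), _, s) => if w[i]? = some a then sourceEntry V (i + 1) s else 0

open Classical in
/-- The table after the application of a rule at position `i`. -/
noncomputable def apply (w : List A) (i : ℕ) (V : Table C) (r : PointerRule A C) : Table C :=
  if entry w V i r = 0 then V else
    Function.update V i (Function.update (V i) r.2.1 (entry w V i r))

/-- The table after the application of all rules at position `i`, `N` times over. -/
noncomputable def applyRow (l : List (PointerRule A C)) (N : ℕ) (w : List A) (V : Table C)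
    (i : ℕ) : Table C :=
  (fun V => l.foldl (apply w i) V)^[N] V

/-- The table after the treatment of the last `k` positions. -/
noncomputable def tabulate (l : List (PointerRule A C)) (N : ℕ) (w : List A) : ℕ → Table C
  | 0 => 0
  | k + 1 => applyRow l N w (tabulate l N w k) (w.length - k)

/-! ### Correctness of the tabulation -/

variable {R : Set (PointerRule A C)} {w : List A} {V W : Table C} {i : ℕ}

theorem entry_of_guard {g : Option (Option A)} {c : C} {s : Option (C × Option C)} {k : ℕ}
    (h : Guard w g i k) : entry w V i (g, c, s) = sourceEntry V k s := by
  rcases g with _ | _ | a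
  · obtain ⟨rfl, -⟩ := h; rfl
  · obtain ⟨rfl, h⟩ := h; exact if_pos h
  · obtain ⟨h, rfl⟩ := h; exact if_pos h

theorem exists_guard_of_entry (hi : i ≤ w.length) {g : Option (Option A)} {c : C}
    {s : Option (C × Option C)} (h : entry w V i (g, c, s) ≠ 0) : ∃ k, Guard w g i k := by
  rcases g with _ | _ | a
  · exact ⟨i, rfl, hi⟩
  · refine ⟨i, rfl, ?_⟩
    by_contra h'
    exact h (if_neg h')
  · refine ⟨i + 1, ?_, rfl⟩
    by_contra h'
    exact h (if_neg h')

/-- The table is correct and, after position `i`, complete; before `i` it is empty. -/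
def SoundAt (R : Set (PointerRule A C)) (w : List A) (i : ℕ) (V : Table C) : Prop :=
  (∀ k ≠ i, ∀ c j, V k c = j + 1 ↔ i < k ∧ Derives R w k c j) ∧
    ∀ c j, V i c = j + 1 → Derives R w i c j

theorem SoundAt.derives (h : SoundAt R w i V) {k j : ℕ} {c : C} (hV : V k c = j + 1) :
    Derives R w k c j := by
  by_cases hk : k = i
  · subst hk; exact h.2 c j hV
  · exact ((h.1 k hk c j).1 hV).2

theorem SoundAt.derives_entry (h : SoundAt R w i V) (hi : i ≤ w.length) {r : PointerRule A C}
    (hr : r ∈ R) {j : ℕ} (hj : entry w V i r = j + 1) : Derives R w i r.2.1 j := by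
  obtain ⟨g, c, s⟩ := r
  obtain ⟨k, hk⟩ := exists_guard_of_entry hi (by rw [hj]; exact j.succ_ne_zero)
  rw [entry_of_guard hk] at hj
  rcases s with _ | ⟨e, _ | f⟩
  · obtain rfl := Nat.succ.inj hj
    exact .here hr hk
  · exact .copy hr hk (h.derives hj)
  · rw [sourceEntry] at hj
    split_ifs at hj with he
    exact .via hr hk (h.derives (Nat.succ_pred_eq_of_ne_zero he).symm) (h.derives hj)

/-- The known entries of `V` are those of `W`. -/
def Extends (V W : Table C) : Prop := ∀ k c, V k c ≠ 0 → W k c = V k c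

theorem Extends.trans {U : Table C} (h : Extends V W) (h' : Extends W U) : Extends V U :=
  fun k c hV => by rw [h' k c (by rwa [h k c hV]), h k c hV]

theorem Extends.antisymm (h : Extends V W) (h' : Extends W V) : V = W := by
  funext k c
  by_cases hV : V k c = 0
  · by_cases hW : W k c = 0
    · rw [hV, hW]
    · exact h' k c hW
  · exact (h k c hV).symm

/-- An entry that is written twice receives the same value twice, since both values are derivable
and `R` is functional. So tables only ever grow. -/
theorem SoundAt.apply (hR : Functional R) (h : SoundAt R w i V) (hi : i ≤ w.length)
    {r : PointerRule A C} (hr : r ∈ R) :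
    SoundAt R w i (apply w i V r) ∧ Extends V (PointerRule.apply w i V r) := by
  classical
  by_cases he : entry w V i r = 0
  · rw [PointerRule.apply, if_pos he]
    exact ⟨h, fun _ _ _ => rfl⟩
  obtain ⟨l, hl⟩ := Nat.exists_eq_succ_of_ne_zero he
  have hd := h.derives_entry hi hr hl
  rw [PointerRule.apply, if_neg he]
  refine ⟨⟨fun k hk c j => ?_, fun c j hj => ?_⟩, fun k c hV => ?_⟩
  · rw [Function.update_of_ne hk]
    exact h.1 k hk c j
  · rw [Function.update_self] at hj
    by_cases hc : c = r.2.1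
    · subst hc
      rw [Function.update_self, hl] at hj
      obtain rfl := Nat.succ.inj hj
      exact hd
    · rw [Function.update_of_ne hc] at hj
      exact h.2 c j hj
  · by_cases hk : k = i
    · subst hk
      rw [Function.update_self]
      by_cases hc : c = r.2.1
      · subst hc
        rw [Function.update_self, hl]
        obtain ⟨j, hj⟩ := Nat.exists_eq_succ_of_ne_zero hV
        rw [hj, hR _ _ _ _ _ hd (h.2 _ _ hj)]
      · rw [Function.update_of_ne hc]
    · rw [Function.update_of_ne hk]

theorem SoundAt.foldl (hR : Functional R) (h : SoundAt R w i V) (hi : i ≤ w.length)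
    {l : List (PointerRule A C)} (hl : ∀ r ∈ l, r ∈ R) :
    SoundAt R w i (l.foldl (PointerRule.apply w i) V) ∧
      Extends V (l.foldl (PointerRule.apply w i) V) := by
  induction l generalizing V with
  | nil => exact ⟨h, fun _ _ _ => rfl⟩
  | cons r l ih =>
    rw [List.forall_mem_cons] at hl
    have h' := h.apply hR hi hl.1
    have h'' := ih h'.1 hl.2
    exact ⟨h''.1, h'.2.trans h''.2⟩

/-- Since each application extends the table, a round that changes nothing in total changes nothing
at any of its rules. -/
theorem SoundAt.entry_ne_zero_of_foldl_eq (hR : Functional R) (h : SoundAt R w i V)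
    (hi : i ≤ w.length) {l : List (PointerRule A C)} (hl : ∀ r ∈ l, r ∈ R)
    (hV : l.foldl (PointerRule.apply w i) V = V) {r : PointerRule A C} (hr : r ∈ l)
    (he : entry w V i r ≠ 0) : V i r.2.1 ≠ 0 := by
  classical
  induction l with
  | nil => cases hr
  | cons s l ih =>
    rw [List.forall_mem_cons] at hl
    have h' := h.apply hR hi hl.1
    have h'' := h'.1.foldl hR hi hl.2
    rw [List.foldl_cons] at hV
    rw [hV] at h''
    have hs := h''.2.antisymm h'.2
    rw [hs] at hV
    rcases List.mem_cons.1 hr with rfl | hr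
    · rw [PointerRule.apply, if_neg he] at hs
      have := congrFun (congrFun hs i) r.2.1
      rw [Function.update_self, Function.update_self] at this
      rwa [← this]
    · exact ih hl.2 hV hr

/-- Induction on the derivation. Later rows are complete by assumption; in row `i`, closure under
the rules provides some value, and functionality makes it the right one. -/
theorem SoundAt.complete (hR : Functional R) (h : SoundAt R w i V)
    (hV : ∀ r ∈ R, entry w V i r ≠ 0 → V i r.2.1 ≠ 0) {k j : ℕ} {c : C}
    (hd : Derives R w k c j) (hk : i ≤ k) : V k c = j + 1 := by
  have key : ∀ {k c j} g s, (g, c, s) ∈ R → Derives R w k c j → i ≤ k →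
      (entry w V k (g, c, s) = j + 1) → V k c = j + 1 := by
    intro k c j g s hr hd hk he
    rcases hk.eq_or_lt with rfl | hk
    · have := hV _ hr (by rw [he]; exact j.succ_ne_zero)
      obtain ⟨l, hl⟩ := Nat.exists_eq_succ_of_ne_zero this
      rw [show V i c = l + 1 from hl, hR _ _ _ _ _ hd (h.2 _ _ hl)]
    · exact (h.1 k hk.ne' c j).2 ⟨hk, hd⟩
  induction hd with
  | here hr hg => exact key _ _ hr (.here hr hg) hk (entry_of_guard hg)
  | copy hr hg hd ih =>
    refine key _ _ hr (.copy hr hg hd) hk ?_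
    rw [entry_of_guard hg]
    exact ih (hk.trans hg.le.1)
  | via hr hg hd hd' ih ih' =>
    refine key _ _ hr (.via hr hg hd hd') hk ?_
    have h₁ := ih (hk.trans hg.le.1)
    rw [entry_of_guard hg, sourceEntry, h₁, if_neg (Nat.succ_ne_zero _)]
    exact ih' (hk.trans (hg.le.1.trans hd.le.1))

theorem SoundAt.iterate (hR : Functional R) (h : SoundAt R w i V) (hi : i ≤ w.length)
    {l : List (PointerRule A C)} (hl : ∀ r ∈ l, r ∈ R) (n : ℕ) :
    SoundAt R w i ((fun V => l.foldl (PointerRule.apply w i) V)^[n] V) := by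
  induction n with
  | zero => exact h
  | succ n ih =>
    rw [Function.iterate_succ_apply']
    exact (ih.foldl hR hi hl).1

/-- A round that changes the table fills at least one new entry of row `i`, because all other rows
are already determined. -/
theorem SoundAt.iterate_eq_or_le (hR : Functional R) (h : SoundAt R w i V) [Finite C]
    (hi : i ≤ w.length) {l : List (PointerRule A C)} (hl : ∀ r ∈ l, r ∈ R) (n : ℕ) :
    l.foldl (PointerRule.apply w i) ((fun V => l.foldl (PointerRule.apply w i) V)^[n] V) =
      (fun V => l.foldl (PointerRule.apply w i) V)^[n] V ∨
    n ≤ {c | (fun V => l.foldl (PointerRule.apply w i) V)^[n] V i c ≠ 0}.ncard := by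
  induction n with
  | zero => exact Or.inr (Nat.zero_le _)
  | succ n ih =>
    rw [Function.iterate_succ_apply']
    have hs := h.iterate hR hi hl n
    generalize (fun V => l.foldl (PointerRule.apply w i) V)^[n] V = U at ih hs
    by_cases hU : l.foldl (PointerRule.apply w i) U = U
    · exact Or.inl (by rw [hU, hU])
    · right
      refine Nat.succ_le_of_lt ((ih.resolve_left hU).trans_lt (Set.ncard_lt_ncard ?_))
      obtain ⟨hs', he⟩ := hs.foldl hR hi hl
      refine (Set.ssubset_iff_of_subset fun c hc => ?_).2 ?_
      · show l.foldl (PointerRule.apply w i) U i c ≠ 0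
        rwa [he i c hc]
      · by_contra! hall
        refine hU (he.antisymm fun k c hc => ?_).symm
        by_cases hk : k = i
        · subst hk
          exact (he k c (hall c hc)).symm
        · obtain ⟨j, hj⟩ := Nat.exists_eq_succ_of_ne_zero hc
          rw [hj, (hs.1 k hk c j).2 ((hs'.1 k hk c j).1 hj)]

theorem tabulate_eq_iff (hR : Functional R) [Finite C] {l : List (PointerRule A C)}
    (hl : ∀ r, r ∈ l ↔ r ∈ R) {k : ℕ} (hk : k ≤ w.length + 1) {c : C} {j : ℕ} :
    tabulate l (Nat.card C + 1) w k i c = j + 1 ↔ w.length < i + k ∧ Derives R w i c j := by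
  induction k generalizing i c j with
  | zero =>
    refine iff_of_false (fun h => by simp [tabulate] at h) fun ⟨h, h'⟩ => ?_
    have := h'.le
    omega
  | succ k ih =>
    have hi : w.length - k ≤ w.length := Nat.sub_le _ _
    have hs : SoundAt R w (w.length - k) (tabulate l (Nat.card C + 1) w k) := by
      refine ⟨fun p hp c j => ?_, fun c j hj => ?_⟩
      · rw [ih (by omega)]
        exact and_congr_left fun _ => by omega
      · rw [ih (by omega)] at hj
        exact hj.2
    have hs' := hs.iterate hR hi (fun r => (hl r).1) (Nat.card C + 1)
    -- A row has only `Nat.card C` entries, so after `Nat.card C + 1` rounds the table is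
    -- stationary.
    have hc := (hs.iterate_eq_or_le hR hi (fun r => (hl r).1) (Nat.card C + 1)).resolve_right
      (not_le.2 (Nat.lt_succ_of_le (Set.ncard_le_card _)))
    show applyRow l (Nat.card C + 1) w _ _ i c = j + 1 ↔ _
    rw [applyRow]
    generalize (fun V => l.foldl (PointerRule.apply w (w.length - k)) V)^[Nat.card C + 1]
      (tabulate l (Nat.card C + 1) w k) = U at hs' hc
    refine ⟨fun h => ⟨?_, hs'.derives h⟩, fun ⟨h, hd⟩ => ?_⟩
    · by_cases hik : i = w.length - k
      · omega
      · have := ((hs'.1 i hik c j).1 h).1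
        omega
    · exact hs'.complete hR (fun r hr => hs'.entry_ne_zero_of_foldl_eq hR hi
        (fun r => (hl r).1) hc ((hl r).2 hr)) hd (by omega)

end PointerRule

/-! ## Compilation of loop-free code to RAM programs -/

namespace RAM

/-- Loop-free code. `ite b₁ b₂` executes `b₁` if the accumulator is positive, and `b₂` if it
is `0`. -/
inductive Block
  | skip
  | load (a : Operand)
  | store (d : Addr)
  | add (k : ℕ)
  | sub (a : Operand)
  | seq (b₁ b₂ : Block)
  | ite (b₁ b₂ : Block)

namespace Block

/-- The effect of loop-free code on the registers. -/
def sem : Block → (ℕ → ℕ) → ℕ → ℕ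
  | skip, m => m
  | load a, m => Function.update m 0 (a.value m)
  | store d, m => Function.update m (d.target m) (m 0)
  | add k, m => Function.update m 0 (m 0 + k)
  | sub a, m => Function.update m 0 (m 0 - a.value m)
  | seq b₁ b₂, m => sem b₂ (sem b₁ m)
  | ite b₁ b₂, m => if m 0 = 0 then sem b₂ m else sem b₁ m

/-- The length of the compiled code. -/
def size : Block → ℕ
  | skip => 0
  | load _ => 1
  | store _ => 1
  | add _ => 1
  | sub _ => 1
  | seq b₁ b₂ => size b₁ + size b₂
  | ite b₁ b₂ => 1 + (size b₁ + (1 + size b₂))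

/-- The compiled code, to be placed at the location `p`. -/
def compile : Block → ℕ → List Instr
  | skip, _ => []
  | load a, _ => [.load a]
  | store d, _ => [.store d]
  | add k, _ => [.add (.lit k)]
  | sub a, _ => [.sub a]
  | seq b₁ b₂, p => compile b₁ p ++ compile b₂ (p + size b₁)
  | ite b₁ b₂, p =>
    .jzero (p + 1 + size b₁ + 1) :: (compile b₁ (p + 1) ++
      .jump (p + 1 + size b₁ + 1 + size b₂) :: compile b₂ (p + 1 + size b₁ + 1))

@[simp]
theorem length_compile (b : Block) (p : ℕ) : (b.compile p).length = b.size := by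
  induction b generalizing p with
  | seq b₁ b₂ h₁ h₂ => simp [compile, size, h₁, h₂]
  | ite b₁ b₂ h₁ h₂ => simp [compile, size, h₁, h₂]; omega
  | _ => rfl

/-- The blocks of a list, one after the other. -/
def seqList : List Block → Block
  | [] => skip
  | b :: l => seq b (seqList l)

/-- A block `n` times over. -/
def replicate (b : Block) : ℕ → Block
  | 0 => skip
  | n + 1 => seq b (replicate b n)

end Block

/-! ### Execution of compiled code -/

/-- The code `l` stands at location `p` of the program `P`. -/
def Placed (P : Program) : ℕ → List Instr → Prop
  | _, [] => True
  | p, i :: l => P[p]? = some i ∧ Placed P (p + 1) l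

theorem placed_append {P : Program} {p : ℕ} {l₁ l₂ : List Instr} :
    Placed P p (l₁ ++ l₂) ↔ Placed P p l₁ ∧ Placed P (p + l₁.length) l₂ := by
  induction l₁ generalizing p with
  | nil => simp [Placed]
  | cons i l₁ ih =>
    rw [List.cons_append, Placed, Placed, ih, and_assoc, List.length_cons,
      Nat.add_assoc p 1, Nat.add_comm 1]

theorem placed_self (P : Program) : Placed P 0 P := by
  suffices ∀ l₁ l₂ : List Instr, Placed (l₁ ++ l₂) l₁.length l₂ from this [] P
  intro l₁ l₂
  induction l₂ generalizing l₁ with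
  | nil => trivial
  | cons i l₂ ih => exact ⟨by simp, by simpa using ih (l₁ ++ [i])⟩

/-- The program gets from `s` to `s'` in at most `T` steps. -/
def Reaches (P : Program) (T : ℕ) (s s' : Config) : Prop := ∃ t ≤ T, (step P)^[t] s = s'

namespace Reaches

variable {P : Program} {T T' : ℕ} {s s' s'' : Config}

theorem refl (P : Program) (s : Config) : Reaches P 0 s s := ⟨0, le_rfl, rfl⟩

theorem trans (h : Reaches P T s s') (h' : Reaches P T' s' s'') : Reaches P (T + T') s s'' := by
  obtain ⟨t, ht, rfl⟩ := h
  obtain ⟨t', ht', rfl⟩ := h'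
  exact ⟨t' + t, by omega, Function.iterate_add_apply ..⟩

theorem mono (h : Reaches P T s s') (hT : T ≤ T') : Reaches P T' s s' := by
  obtain ⟨t, ht, h⟩ := h
  exact ⟨t, ht.trans hT, h⟩

theorem head {i : Instr} (hi : P[s.pc]? = some i) (h : Reaches P T (exec s i) s') :
    Reaches P (T + 1) s s' := by
  obtain ⟨t, ht, rfl⟩ := h
  refine ⟨t + 1, by omega, ?_⟩
  rw [Function.iterate_succ_apply, step, hi]

theorem single {i : Instr} (hi : P[s.pc]? = some i) : Reaches P 1 s (exec s i) :=
  head hi (refl P _)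

end Reaches

/-- All jumps lead forward, so each instruction is executed at most once and the size of the code
bounds its time. -/
theorem Block.reaches {P : Program} (b : Block) {p : ℕ} (hP : Placed P p (b.compile p))
    (m : ℕ → ℕ) (x : List ℕ) : Reaches P b.size ⟨p, m, x⟩ ⟨p + b.size, b.sem m, x⟩ := by
  induction b generalizing p m with
  | skip => exact .refl P _
  | load a => exact .single (s := ⟨p, m, x⟩) hP.1
  | store d => exact .single (s := ⟨p, m, x⟩) hP.1
  | add k => exact .single (s := ⟨p, m, x⟩) hP.1
  | sub a => exact .single (s := ⟨p, m, x⟩) hP.1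
  | seq b₁ b₂ h₁ h₂ =>
    rw [compile, placed_append, length_compile] at hP
    have := (h₁ hP.1 m).trans (h₂ hP.2 (b₁.sem m))
    rwa [Nat.add_assoc] at this
  | ite b₁ b₂ h₁ h₂ =>
    rw [compile, Placed, placed_append, length_compile, Placed] at hP
    obtain ⟨hP₀, hP₁, hP', hP₂⟩ := hP
    have he : p + (ite b₁ b₂).size = p + 1 + b₁.size + 1 + b₂.size := by rw [size]; omega
    rw [he]
    by_cases hm : m 0 = 0
    · have h := Reaches.head (s := ⟨p, m, x⟩) hP₀ (T := b₂.size)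
        (s' := ⟨p + 1 + b₁.size + 1 + b₂.size, b₂.sem m, x⟩) (by
          simp only [exec, hm, if_true]
          exact h₂ hP₂ m)
      rw [sem, if_pos hm]
      exact h.mono (by rw [size]; omega)
    · have h := Reaches.head (s := ⟨p, m, x⟩) hP₀ (T := b₁.size + 1)
        (s' := ⟨p + 1 + b₁.size + 1 + b₂.size, b₁.sem m, x⟩) (by
          simp only [exec, hm, if_false]
          exact (h₁ hP₁ m).trans (.single (s := ⟨p + 1 + b₁.size, b₁.sem m, x⟩) hP'))
      rw [sem, if_neg hm]
      exact h.mono (by rw [size]; omega)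

/-! ### The growth of the numbers in the registers -/

/-- The instruction adds and loads no literals above `κ`, and adds only literals. -/
def Instr.LiteralBound (κ : ℕ) : Instr → Prop
  | .load (.lit k) => k ≤ κ
  | .add (.lit k) => k ≤ κ
  | .add (.at _) => False
  | _ => True

theorem Instr.LiteralBound.mono {κ κ' : ℕ} (h : κ ≤ κ') {i : Instr} (hi : i.LiteralBound κ) :
    i.LiteralBound κ' := by
  unfold LiteralBound at *
  split at hi <;> first | exact hi.trans h | trivial

theorem exists_literalBound {l : List Instr} (h : ∀ i ∈ l, ∃ κ, i.LiteralBound κ) :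
    ∃ κ, ∀ i ∈ l, i.LiteralBound κ := by
  induction l with
  | nil => exact ⟨0, by simp⟩
  | cons i l ih =>
    rw [List.forall_mem_cons] at h
    obtain ⟨κ, hκ⟩ := h.1
    obtain ⟨κ', hκ'⟩ := ih h.2
    refine ⟨max κ κ', List.forall_mem_cons.2 ⟨hκ.mono (le_max_left ..), fun j hj =>
      (hκ' j hj).mono (le_max_right ..)⟩⟩

theorem Block.literalBound (b : Block) (p : ℕ) : ∀ i ∈ b.compile p, ∃ κ, i.LiteralBound κ := by
  induction b generalizing p with
  | skip => simp [compile]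
  | load a =>
    rcases a with k | a
    · simpa [compile] using ⟨k, le_refl k⟩
    · simp [compile, Instr.LiteralBound]
  | store d => simp [compile, Instr.LiteralBound]
  | add k => simpa [compile] using ⟨k, le_refl k⟩
  | sub a => simp [compile, Instr.LiteralBound]
  | seq b₁ b₂ h₁ h₂ =>
    simp only [compile, List.mem_append]
    rintro i (h | h)
    · exact h₁ _ i h
    · exact h₂ _ i h
  | ite b₁ b₂ h₁ h₂ =>
    simp only [compile, List.mem_append, List.mem_cons]
    rintro i (rfl | h | rfl | h)
    · exact ⟨0, trivial⟩
    · exact h₁ _ i h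
    · exact ⟨0, trivial⟩
    · exact h₂ _ i h

/-- Numbers enter from literals or the input, and they grow only by the addition of literals; so one
step raises the maximum by at most `κ`. -/
theorem exec_bound {κ B : ℕ} {i : Instr} (hi : i.LiteralBound κ) {s : Config}
    (hm : ∀ r, s.mem r ≤ B) (hx : ∀ k ∈ s.input, k ≤ κ) :
    (∀ r, (exec s i).mem r ≤ B + κ) ∧ ∀ k ∈ (exec s i).input, k ≤ κ := by
  have hu : ∀ a v, v ≤ B + κ → ∀ r, Function.update s.mem a v r ≤ B + κ := fun a v hv r => by
    rcases eq_or_ne r a with rfl | h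
    · rwa [Function.update_self]
    · rw [Function.update_of_ne h]; exact (hm r).trans (Nat.le_add_right ..)
  have hm' : ∀ r, s.mem r ≤ B + κ := fun r => (hm r).trans (Nat.le_add_right ..)
  cases i with
  | load a =>
    refine ⟨hu _ _ ?_, hx⟩
    rcases a with k | d
    · exact le_add_left hi
    · exact hm' _
  | store d => exact ⟨hu _ _ (hm' _), hx⟩
  | add a =>
    refine ⟨hu _ _ ?_, hx⟩
    rcases a with k | d
    · exact add_le_add (hm 0) hi
    · exact hi.elim
  | sub a => exact ⟨hu _ _ ((Nat.sub_le _ _).trans (hm' 0)), hx⟩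
  | read d =>
    refine ⟨hu _ _ ?_, fun k hk => hx k (List.mem_of_mem_tail hk)⟩
    cases h : s.input with
    | nil => exact Nat.zero_le _
    | cons k l => exact le_add_left (hx k (by simp [h]))
  | jump l => exact ⟨hm', hx⟩
  | jzero l => exact ⟨hm', hx⟩
  | jgtz l => exact ⟨hm', hx⟩
  | accept => exact ⟨hm', hx⟩
  | reject => exact ⟨hm', hx⟩

theorem run_bound {P : Program} {κ : ℕ} (hP : ∀ i ∈ P, i.LiteralBound κ) {x : List ℕ}
    (hx : ∀ k ∈ x, k ≤ κ) (t : ℕ) :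
    (∀ r, (run P x t).mem r ≤ t * κ) ∧ ∀ k ∈ (run P x t).input, k ≤ κ := by
  induction t with
  | zero => exact ⟨fun r => Nat.zero_le _, hx⟩
  | succ t ih =>
    rw [run, Function.iterate_succ_apply', step, ← run]
    split
    · exact ⟨fun r => (ih.1 r).trans (Nat.mul_le_mul_right _ t.le_succ), ih.2⟩
    · next i hi =>
      rw [Nat.succ_mul]
      exact exec_bound (hP i (List.mem_of_getElem? hi)) ih.1 ih.2

theorem run_eq_of_halted {P : Program} {x : List ℕ} {s t : ℕ} (hst : s ≤ t) {i : Instr}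
    (hs : P[(run P x s).pc]? = some i) (hi : i = .accept ∨ i = .reject) :
    run P x t = run P x s := by
  induction t, hst using Nat.le_induction with
  | base => rfl
  | succ t _ ih =>
    rw [run, Function.iterate_succ_apply', ← run, ih, step, hs]
    rcases hi with rfl | rfl <;> rfl

theorem decidesInLinearTime_of_reaches {A : Type*} [Finite A] {code : A → ℕ} {P : Program}
    {L : Language A} (hP : ∀ i ∈ P, ∃ κ, i.LiteralBound κ) (c : ℕ)
    (h : ∀ w : List A, ∃ s, Reaches P (c * (w.length + 1)) ⟨0, fun _ => 0, w.map code⟩ s ∧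
      (w ∈ L → P[s.pc]? = some .accept) ∧ (w ∉ L → P[s.pc]? = some .reject)) :
    DecidesInLinearTime code P L := by
  obtain ⟨κ, hκ⟩ := exists_literalBound hP
  obtain ⟨κ', hκ'⟩ := (Set.finite_range code).bddAbove
  have hP' : ∀ i ∈ P, i.LiteralBound (κ + κ') := fun i hi => (hκ i hi).mono (Nat.le_add_right ..)
  -- One constant serves for both time and register size: a step adds at most `κ + κ'`, and the
  -- summand `1` keeps the time bound valid if this is `0`.
  refine ⟨c * (κ + κ' + 1), fun w => ?_⟩
  have hx : ∀ k ∈ w.map code, k ≤ κ + κ' := fun k hk => by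
    obtain ⟨a, -, rfl⟩ := List.mem_map.1 hk
    exact le_add_left (hκ' ⟨a, rfl⟩)
  obtain ⟨_, ⟨s, hs, rfl⟩, hacc, hrej⟩ := h w
  have hle : c * (w.length + 1) * (κ + κ' + 1) = c * (κ + κ' + 1) * (w.length + 1) :=
    Nat.mul_right_comm ..
  have hs' : s ≤ c * (κ + κ' + 1) * (w.length + 1) :=
    hs.trans (hle ▸ Nat.le_mul_of_pos_right _ (Nat.succ_pos _))
  refine ⟨fun hw => ⟨s, hs', hacc hw⟩, fun hw => ⟨s, hs', hrej hw⟩, fun t r => ?_⟩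
  have hbound : ∀ t ≤ s, (run P (w.map code) t).mem r ≤ c * (κ + κ' + 1) * (w.length + 1) :=
    fun t ht => ((run_bound hP' hx t).1 r).trans
      (hle ▸ Nat.mul_le_mul (ht.trans hs) (Nat.le_succ _))
  rcases le_total t s with ht | ht
  · exact hbound t ht
  · have : run P (w.map code) t = run P (w.map code) s := by
      by_cases hw : w ∈ L
      · exact run_eq_of_halted ht (hacc hw) (Or.inl rfl)
      · exact run_eq_of_halted ht (hrej hw) (Or.inr rfl)
    rw [this]
    exact hbound s le_rfl

end RAM

/-! ## Computing the table of a pointer system on a RAM -/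

namespace RAM

open PointerRule

variable {A : Type*} {C : Type}

/-! ### Register layout and the code for one row -/

/-- The number that represents a table entry: `0`, or the address of the row that is pointed to. -/
def rowPointer (K : ℕ) : ℕ → ℕ
  | 0 => 0
  | j + 1 => 4 + K * j

theorem rowPointer_eq_zero {K v : ℕ} : rowPointer K v = 0 ↔ v = 0 := by
  cases v <;> simp [rowPointer]

/-- The registers contain the word `x` and the table `V`, both arranged in rows of length `K`, and
register `1` points to the row `i`. -/
def Represents (K : ℕ) (idx : C → ℕ) (x : List ℕ) (V : Table C) (i : ℕ) (m : ℕ → ℕ) : Prop :=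
  m 1 = 4 + K * i ∧ (∀ j, m (4 + K * j) = x.getD j 0) ∧
    ∀ j c, m (4 + K * j + (1 + idx c)) = rowPointer K (V j c)

/-- The rows begin at register `4`; registers `0`, `2` and `3` are scratch space. -/
theorem Represents.congr {K : ℕ} {idx : C → ℕ} {x : List ℕ} {V : Table C} {i : ℕ} {m m' : ℕ → ℕ}
    (h : Represents K idx x V i m) (hm : ∀ a, a ≠ 0 → a ≠ 2 → a ≠ 3 → m' a = m a) :
    Represents K idx x V i m' :=
  ⟨(hm 1 (by decide) (by decide) (by decide)).trans h.1,
    fun j => (hm _ (by omega) (by omega) (by omega)).trans (h.2.1 j),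
    fun j c => (hm _ (by omega) (by omega) (by omega)).trans (h.2.2 j c)⟩

/-- Load the source of a rule, relative to the row at distance `d` from the current one. -/
def sourceBlock (idx : C → ℕ) (d : ℕ) : Option (C × Option C) → Block
  | none => .seq (.load (.at (.reg 1))) (.add d)
  | some (e, none) => .seq (.load (.at (.reg 1))) (.seq (.add (d + (1 + idx e)))
      (.seq (.store (.reg 2)) (.load (.at (.ind 2)))))
  | some (e, some f) => .seq (.load (.at (.reg 1))) (.seq (.add (d + (1 + idx e)))
      (.seq (.store (.reg 2)) (.seq (.load (.at (.ind 2)))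
        (.ite (.seq (.add (1 + idx f)) (.seq (.store (.reg 2)) (.load (.at (.ind 2))))) .skip))))

/-- Load the entry that a rule yields in the current row. -/
def entryBlock (code : A → ℕ) (K : ℕ) (idx : C → ℕ) : PointerRule A C → Block
  | (none, _, s) => sourceBlock idx 0 s
  | (some none, _, s) => .seq (.load (.at (.ind 1))) (.ite (.load (.lit 0)) (sourceBlock idx 0 s))
  | (some (some a), _, s) => .seq (.load (.at (.ind 1))) (.seq (.sub (.lit (code a)))
      (.ite (.load (.lit 0)) (.seq (.load (.lit (code a))) (.seq (.sub (.at (.ind 1)))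
        (.ite (.load (.lit 0)) (sourceBlock idx K s))))))

/-- Apply a rule in the current row. -/
def ruleBlock (code : A → ℕ) (K : ℕ) (idx : C → ℕ) (r : PointerRule A C) : Block :=
  .seq (entryBlock code K idx r)
    (.ite (.seq (.store (.reg 3)) (.seq (.load (.at (.reg 1))) (.seq (.add (1 + idx r.2.1))
      (.seq (.store (.reg 2)) (.seq (.load (.at (.reg 3))) (.store (.ind 2))))))) .skip)

/-- A nonzero entry is already the address of a row, so adding the constant offset of the second
cell gives the register to be looked up. -/
theorem sourceBlock_spec {K : ℕ} {idx : C → ℕ} {x : List ℕ} {V : Table C} {i : ℕ} {m : ℕ → ℕ}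
    (h : Represents K idx x V i m) (n : ℕ) (s : Option (C × Option C)) :
    (sourceBlock idx (K * n) s).sem m 0 = rowPointer K (sourceEntry V (i + n) s) ∧
      ∀ a, a ≠ 0 → a ≠ 2 → (sourceBlock idx (K * n) s).sem m a = m a := by
  have hadd : ∀ o, 4 + K * i + (K * n + o) = 4 + K * (i + n) + o := fun o => by ring
  rcases s with _ | ⟨e, _ | f⟩
  · refine ⟨?_, fun a h₀ h₂ => ?_⟩
    · have := hadd 0
      simp only [Nat.add_zero] at this
      simp [sourceBlock, Block.sem, Operand.value, Addr.target, h.1, sourceEntry, rowPointer, this]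
    · simp [sourceBlock, Block.sem, h₀]
  · refine ⟨?_, fun a h₀ h₂ => ?_⟩
    · have hne : 4 + K * (i + n) + (1 + idx e) ≠ 0 ∧ 4 + K * (i + n) + (1 + idx e) ≠ 2 := by omega
      simp [sourceBlock, Block.sem, Operand.value, Addr.target, h.1, sourceEntry, hadd,
        hne, h.2.2]
    · simp [sourceBlock, Block.sem, h₀, h₂, Addr.target]
  · have hne : ∀ j c, 4 + K * j + (1 + idx c) ≠ 0 ∧ 4 + K * j + (1 + idx c) ≠ 2 := by omega
    by_cases he : V (i + n) e = 0
    · refine ⟨?_, fun a h₀ h₂ => ?_⟩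
      · simp [sourceBlock, Block.sem, Operand.value, Addr.target, h.1, sourceEntry, hadd,
          hne, h.2.2, he, rowPointer]
      · simp [sourceBlock, Block.sem, Operand.value, Addr.target, h.1, hadd,
          hne, h.2.2, he, rowPointer, h₀, h₂]
    · obtain ⟨j, hj⟩ := Nat.exists_eq_succ_of_ne_zero he
      refine ⟨?_, fun a h₀ h₂ => ?_⟩
      · simp [sourceBlock, Block.sem, Operand.value, Addr.target, h.1, sourceEntry, hadd,
          hne, h.2.2, hj, rowPointer]
      · simp [sourceBlock, Block.sem, Operand.value, Addr.target, h.1, hadd,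
          hne, h.2.2, hj, rowPointer, h₀, h₂]

/-- The end of the word shows as a `0`, which codes no letter. Equality with a letter holds if and
only if both truncated differences vanish. -/
theorem entryBlock_spec {code : A → ℕ} (hcode : Function.Injective code) (hpos : ∀ a, code a ≠ 0)
    {K : ℕ} {idx : C → ℕ} {w : List A} {V : Table C} {i : ℕ} {m : ℕ → ℕ} (hi : i ≤ w.length)
    (h : Represents K idx (w.map code) V i m) (r : PointerRule A C) :
    (entryBlock code K idx r).sem m 0 = rowPointer K (entry w V i r) ∧
      ∀ a, a ≠ 0 → a ≠ 2 → (entryBlock code K idx r).sem m a = m a := by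
  have hletter : m (m 1) = (w.map code).getD i 0 := by rw [h.1, h.2.1]
  have hm1 : m 1 ≠ 0 := by rw [h.1]; omega
  have hload : ∀ v a, a ≠ 0 → Function.update m 0 v a = m a := fun v a ha =>
    Function.update_of_ne ha _ _
  have hrep : ∀ v, Represents K idx (w.map code) V i (Function.update m 0 v) := fun v =>
    h.congr fun a ha _ _ => hload v a ha
  have hsource : ∀ v n s, (sourceBlock idx (K * n) s).sem (Function.update m 0 v) 0 =
      rowPointer K (sourceEntry V (i + n) s) ∧ ∀ a, a ≠ 0 → a ≠ 2 →
        (sourceBlock idx (K * n) s).sem (Function.update m 0 v) a = m a := fun v n s =>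
    ⟨(sourceBlock_spec (hrep v) n s).1, fun a h₀ h₂ =>
      ((sourceBlock_spec (hrep v) n s).2 a h₀ h₂).trans (hload v a h₀)⟩
  obtain ⟨_ | _ | a, c, s⟩ := r
  · exact sourceBlock_spec h 0 s
  · have hz : m (m 1) = 0 ↔ i = w.length := by
      rw [hletter]
      rcases hi.eq_or_lt with rfl | hlt
      · simp
      · simp [List.getD_eq_getElem?_getD, hlt, hpos, hlt.ne]
    by_cases hl : i = w.length
    · have hsem : (entryBlock code K idx (some none, c, s)).sem m =
          (sourceBlock idx (K * 0) s).sem (Function.update m 0 0) := by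
        simp [entryBlock, Block.sem, Operand.value, Addr.target, hz.2 hl]
      rw [hsem, entry, if_pos hl]
      exact hsource 0 0 s
    · have hsem : (entryBlock code K idx (some none, c, s)).sem m = Function.update m 0 0 := by
        simp [entryBlock, Block.sem, Operand.value, Addr.target, mt hz.1 hl]
      rw [hsem, entry, if_neg hl]
      exact ⟨rfl, fun a h₀ _ => hload 0 a h₀⟩
  · have hz : m (m 1) = code a ↔ w[i]? = some a := by
      rw [hletter]
      rcases hi.eq_or_lt with rfl | hlt
      · simpa using (hpos a).symm
      · simp [List.getD_eq_getElem?_getD, hlt, hcode.eq_iff]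
    by_cases hl : w[i]? = some a
    · have hsem : (entryBlock code K idx (some (some a), c, s)).sem m =
          (sourceBlock idx (K * 1) s).sem (Function.update m 0 0) := by
        simp [entryBlock, Block.sem, Operand.value, Addr.target, hload _ _ hm1, hz.2 hl]
      rw [hsem, entry, if_pos hl]
      exact hsource 0 1 s
    · have hne := mt hz.1 hl
      have hsem : (entryBlock code K idx (some (some a), c, s)).sem m = Function.update m 0 0 := by
        by_cases hle : m (m 1) - code a = 0
        · have hle' : code a - m (m 1) ≠ 0 := by omega
          simp [entryBlock, Block.sem, Operand.value, Addr.target, hload _ _ hm1, hle, hle']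
        · simp [entryBlock, Block.sem, Operand.value, Addr.target, hle]
      rw [hsem, entry, if_neg hl]
      exact ⟨rfl, fun a h₀ _ => hload 0 a h₀⟩

/-- Distinct cells have distinct places in the rows of length `K`, none of them the first. -/
def Layout (K : ℕ) (idx : C → ℕ) : Prop := Function.Injective idx ∧ (∀ c, 1 + idx c < K) ∧ 0 < K

theorem layout_eq {K i j o o' : ℕ} (ho : o < K) (ho' : o' < K)
    (h : 4 + K * i + o = 4 + K * j + o') : i = j ∧ o = o' := by
  have h' : K * i + o = K * j + o' := by omega
  have h₁ := congrArg (· / K) h'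
  have h₂ := congrArg (· % K) h'
  simpa [Nat.mul_add_div (Nat.zero_lt_of_lt ho), Nat.div_eq_of_lt, Nat.mod_eq_of_lt, ho, ho']
    using And.intro h₁ h₂

theorem ruleBlock_spec {code : A → ℕ} (hcode : Function.Injective code) (hpos : ∀ a, code a ≠ 0)
    {K : ℕ} {idx : C → ℕ} (hK : Layout K idx) {w : List A} {V : Table C} {i : ℕ} {m : ℕ → ℕ}
    (hi : i ≤ w.length) (h : Represents K idx (w.map code) V i m) (r : PointerRule A C) :
    Represents K idx (w.map code) (apply w i V r) i ((ruleBlock code K idx r).sem m) := by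
  classical
  obtain ⟨h₀, hm⟩ := entryBlock_spec hcode hpos hi h r
  have h' := h.congr fun a h₀ h₂ _ => hm a h₀ h₂
  generalize hm' : (entryBlock code K idx r).sem m = m' at h₀ hm h'
  by_cases he : entry w V i r = 0
  · have : (ruleBlock code K idx r).sem m = m' := by
      rw [ruleBlock, Block.sem, hm', Block.sem, if_pos (by rw [h₀, rowPointer_eq_zero, he])]
      rfl
    rw [this, apply, if_pos he]
    exact h'
  · have hne : m' 0 ≠ 0 := by rwa [h₀, Ne, rowPointer_eq_zero]
    -- Outside the scratch registers only the place of the target cell in row `i` can change.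
    have hsem : ∀ a, a ≠ 0 → a ≠ 2 → a ≠ 3 → (ruleBlock code K idx r).sem m a =
        if a = 4 + K * i + (1 + idx r.2.1) then rowPointer K (entry w V i r) else m' a := by
      intro a h₀' h₂ h₃
      rw [ruleBlock, Block.sem, hm', Block.sem, if_neg hne]
      simp [Block.sem, Operand.value, Addr.target, Function.update_apply, h₀', h₂, h₃, h'.1, h₀]
    have hlt := hK.2.1
    rw [apply, if_neg he]
    refine ⟨?_, fun j => ?_, fun j c => ?_⟩
    · rw [hsem 1 (by decide) (by decide) (by decide), if_neg (by omega), h'.1]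
    · rw [hsem _ (by omega) (by omega) (by omega), if_neg, h'.2.1]
      intro heq
      have := (layout_eq (o := 0) (Nat.zero_lt_of_lt (hlt r.2.1)) (hlt r.2.1) heq).2
      omega
    · rw [hsem _ (by omega) (by omega) (by omega)]
      split_ifs with heq
      · obtain ⟨rfl, hc⟩ := layout_eq (hlt c) (hlt r.2.1) heq
        obtain rfl := hK.1 (Nat.add_left_cancel hc)
        rw [Function.update_self, Function.update_self]
      · rw [h'.2.2]
        by_cases hj : j = i
        · subst hj
          have hc : c ≠ r.2.1 := by rintro rfl; exact heq rfl
          rw [Function.update_self, Function.update_of_ne hc]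
        · rw [Function.update_of_ne hj]

/-- Treat the current row. -/
def rowBlock (code : A → ℕ) (K : ℕ) (idx : C → ℕ) (l : List (PointerRule A C)) (N : ℕ) : Block :=
  .replicate (.seqList (l.map (ruleBlock code K idx))) N

theorem rowBlock_spec {code : A → ℕ} (hcode : Function.Injective code) (hpos : ∀ a, code a ≠ 0)
    {K : ℕ} {idx : C → ℕ} (hK : Layout K idx) (l : List (PointerRule A C)) (N : ℕ) {w : List A}
    {V : Table C} {i : ℕ} {m : ℕ → ℕ} (hi : i ≤ w.length)
    (h : Represents K idx (w.map code) V i m) :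
    Represents K idx (w.map code) (applyRow l N w V i) i
      ((rowBlock code K idx l N).sem m) := by
  have hround : ∀ {V m}, Represents K idx (w.map code) V i m → Represents K idx (w.map code)
      (l.foldl (apply w i) V) i ((Block.seqList (l.map (ruleBlock code K idx))).sem m) := by
    induction l with
    | nil => exact fun h => h
    | cons r l ih => exact fun h => ih (ruleBlock_spec hcode hpos hK hi h r)
  rw [rowBlock, applyRow]
  induction N generalizing V m with
  | zero => exact h
  | succ N ih => exact ih (hround h)

open Classical in
/-- Load `1` if `s`, together with the cells of a list that have a value in the first row, is a
member of `Φ`, and `0` otherwise. -/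
noncomputable def decisionBlock (idx : C → ℕ) (Φ : Set (Set C)) : List C → Set C → Block
  | [], s => .load (.lit (if s ∈ Φ then 1 else 0))
  | c :: l, s => .seq (.load (.at (.reg (4 + (1 + idx c)))))
      (.ite (decisionBlock idx Φ l (insert c s)) (decisionBlock idx Φ l s))

/-- The block is a binary decision tree over the cells; `s` collects the cells found nonzero on the
current branch, and the leaves hold the answers. -/
theorem decisionBlock_spec {K : ℕ} {idx : C → ℕ} {x : List ℕ} {V : Table C} {i : ℕ} {m : ℕ → ℕ}
    (h : Represents K idx x V i m) (Φ : Set (Set C)) (l : List C) (s : Set C) :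
    (decisionBlock idx Φ l s).sem m 0 ≠ 0 ↔ s ∪ {c | c ∈ l ∧ V 0 c ≠ 0} ∈ Φ := by
  induction l generalizing m s with
  | nil => simp [decisionBlock, Block.sem, Operand.value]
  | cons c l ih =>
    have h' : ∀ v, Represents K idx x V i (Function.update m 0 v) := fun v =>
      h.congr fun a ha _ _ => Function.update_of_ne ha _ _
    have hc : m (4 + (1 + idx c)) = rowPointer K (V 0 c) := h.2.2 0 c
    simp only [decisionBlock, Block.sem, Operand.value, Addr.target, Function.update_self, hc,
      rowPointer_eq_zero]
    split_ifs with hV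
    · rw [ih (h' _)]
      refine iff_of_eq (congrArg (fun s => s ∈ Φ) (Set.ext fun d => ?_))
      simp only [Set.mem_union, Set.mem_ofPred_eq, List.mem_cons]
      by_cases hd : d = c
      · subst hd; simp [hV]
      · simp [hd]
    · rw [ih (h' _)]
      refine iff_of_eq (congrArg (fun s => s ∈ Φ) (Set.ext fun d => ?_))
      simp only [Set.mem_union, Set.mem_ofPred_eq, List.mem_cons, Set.mem_insert_iff]
      by_cases hd : d = c
      · subst hd; simp [hV]
      · simp [hd]

/-! ### The whole program and its running time -/

/-- Read the input into the rows, treat the rows from the last to the first by `b`, and decide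
by `d`. -/
def rowProgram (K : ℕ) (b d : Block) : Program :=
  [.load (.lit 4), .store (.reg 1), .read (.ind 1), .load (.at (.ind 1)), .jzero 9,
    .load (.at (.reg 1)), .add (.lit K), .store (.reg 1), .jump 2] ++
  (b.compile 9 ++
  ([.load (.at (.reg 1)), .sub (.lit 4), .jzero (9 + b.size + 7), .load (.at (.reg 1)),
    .sub (.lit K), .store (.reg 1), .jump 9] ++
  (d.compile (9 + b.size + 7) ++
  [.jzero (9 + b.size + 7 + d.size + 2), .accept, .reject])))

theorem rowProgram_literalBound (K : ℕ) (b d : Block) :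
    ∀ i ∈ rowProgram K b d, ∃ κ, i.LiteralBound κ := by
  have h : ∀ i : Instr, i.LiteralBound (4 + K) → ∃ κ, i.LiteralBound κ := fun i h => ⟨_, h⟩
  simp only [rowProgram, List.forall_mem_append]
  refine ⟨fun i hi => h i ?_, b.literalBound _, fun i hi => h i ?_, d.literalBound _,
    fun i hi => h i ?_⟩ <;>
  · simp only [List.mem_cons, List.not_mem_nil, or_false] at hi
    rcases hi with rfl | rfl | rfl | rfl | rfl | rfl | rfl | rfl | rfl <;>
      simp [Instr.LiteralBound]

/-- Each letter costs the seven instructions of the loop, and the terminating `0` costs the first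
three. Since `0 ∉ x`, the loop stops exactly at the row after the last letter, which represents the
end of the word. -/
theorem reaches_read_input {P : Program} {K : ℕ} {idx : C → ℕ} (hK : Layout K idx)
    (hP : Placed P 2 [.read (.ind 1), .load (.at (.ind 1)), .jzero 9,
      .load (.at (.reg 1)), .add (.lit K), .store (.reg 1), .jump 2])
    {x : List ℕ} (hx : 0 ∉ x) {i n : ℕ} (hn : x.length = i + n) {m : ℕ → ℕ}
    (hm : Represents K idx (x.take i) 0 i m) :
    ∃ m' y, Represents K idx x 0 x.length m' ∧
      Reaches P (7 * n + 3) ⟨2, m, x.drop i⟩ ⟨9, m', y⟩ := by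
  obtain ⟨h2, h3, h4, h5, h6, h7, h8, -⟩ := id hP
  have hlt := hK.2.1
  have hK0 := hK.2.2
  let m₁ := Function.update m (m 1) ((x.drop i).headD 0)
  have hval : (x.drop i).headD 0 = x.getD i 0 := by
    rw [List.getD_eq_getElem?_getD, List.headD_eq_head?_getD, List.head?_drop]
  have hself : m₁ (m 1) = x.getD i 0 := (Function.update_self ..).trans hval
  have hother : ∀ a ≠ m 1, m₁ a = m a := fun a ha => Function.update_of_ne ha _ _
  have hm₁ : Represents K idx (x.take (i + 1)) 0 i m₁ := by
    refine ⟨?_, fun j => ?_, fun j c => ?_⟩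
    · rw [hother 1 (by rw [hm.1]; omega), hm.1]
    · by_cases hj : j = i
      · subst hj
        rw [← hm.1, hself]
        simp [List.getD_eq_getElem?_getD]
      · rw [hother, hm.2.1]
        · simp only [List.getD_eq_getElem?_getD, List.getElem?_take]
          congr 1
          split_ifs <;> first | rfl | omega
        · rw [hm.1]
          exact fun h => hj (layout_eq (o := 0) (o' := 0) hK0 hK0 h).1
    · rw [hother, hm.2.2]
      rw [hm.1]
      intro h
      have := (layout_eq (o' := 0) (hlt c) hK0 h).2
      omega
  let m₂ := Function.update m₁ 0 (x.getD i 0)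
  have hm₂ : Represents K idx (x.take (i + 1)) 0 i m₂ :=
    hm₁.congr fun a ha _ _ => Function.update_of_ne ha _ _
  have hstart : Reaches P 2 ⟨2, m, x.drop i⟩ ⟨4, m₂, (x.drop i).tail⟩ := by
    refine .head h2 (.head h3 ?_)
    have : m₁ (m₁ 1) = x.getD i 0 := by
      rw [hm₁.1, hm₁.2.1]
      simp [List.getD_eq_getElem?_getD]
    have he : exec (exec ⟨2, m, x.drop i⟩ (.read (.ind 1))) (.load (.at (.ind 1))) =
        ⟨4, Function.update m₁ 0 (m₁ (m₁ 1)), (x.drop i).tail⟩ := rfl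
    rw [he, this]
    exact .refl P _
  cases n with
  | zero =>
    obtain rfl : i = x.length := hn.symm
    rw [List.take_of_length_le (Nat.le_succ _)] at hm₂
    have he : m₂ 0 = 0 := by simp [m₂]
    have hend : Reaches P 1 ⟨4, m₂, (x.drop x.length).tail⟩ ⟨9, m₂, (x.drop x.length).tail⟩ := by
      refine .head h4 ?_
      simp only [exec, he, if_true]
      exact .refl P _
    exact ⟨m₂, _, hm₂, hstart.trans hend⟩
  | succ n =>
    have hi : i < x.length := by omega
    have hne : m₂ 0 ≠ 0 := by
      simp only [m₂, Function.update_self, List.getD_eq_getElem _ _ hi]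
      exact fun h => hx (h ▸ List.getElem_mem hi)
    let m₃ := Function.update (Function.update m₂ 0 (m₂ 1 + K)) 1 (m₂ 1 + K)
    have hm₃ : Represents K idx (x.take (i + 1)) 0 (i + 1) m₃ := by
      refine ⟨?_, fun j => ?_, fun j c => ?_⟩
      · simp only [m₃, Function.update_self, hm₂.1]; ring
      · rw [← hm₂.2.1]
        simp only [m₃]
        rw [Function.update_of_ne (by omega), Function.update_of_ne (by omega)]
      · rw [← hm₂.2.2]
        simp only [m₃]
        rw [Function.update_of_ne (by omega), Function.update_of_ne (by omega)]
    have hloop : Reaches P 5 ⟨4, m₂, (x.drop i).tail⟩ ⟨2, m₃, x.drop (i + 1)⟩ := by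
      refine .head h4 ?_
      simp only [exec, hne, if_false]
      refine .head h5 (.head h6 (.head h7 (.head h8 ?_)))
      have he : exec (exec (exec (exec ⟨5, m₂, (x.drop i).tail⟩ (.load (.at (.reg 1))))
          (.add (.lit K))) (.store (.reg 1))) (.jump 2) = ⟨2, m₃, x.drop (i + 1)⟩ := by
        simp [exec, Operand.value, Addr.target, m₃]
      rw [he]
      exact .refl P _
    obtain ⟨m', y, hm', h⟩ := reaches_read_input hK hP hx (i := i + 1) (n := n) (by omega) hm₃
    exact ⟨m', y, hm', ((hstart.trans hloop).trans h).mono (by omega)⟩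
termination_by n

/-- After the treatment of row `i`, register `1` minus `4` is `K * i`, which vanishes only for the
first row because `K` is positive. A row costs at most `b.size` steps and the seven instructions of
the loop. -/
theorem reaches_treat_rows {P : Program} {p q K : ℕ} {b : Block} {idx : C → ℕ}
    (hK : Layout K idx)
    (hb : Placed P p (b.compile p))
    (hP : Placed P (p + b.size) [.load (.at (.reg 1)), .sub (.lit 4), .jzero q,
      .load (.at (.reg 1)), .sub (.lit K), .store (.reg 1), .jump p]) {x : List ℕ}
    {T : ℕ → Table C} {n : ℕ}
    (hT : ∀ k m, k ≤ n → Represents K idx x (T k) (n - k) m →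
      Represents K idx x (T (k + 1)) (n - k) (b.sem m))
    {i k : ℕ} (hik : k + i = n) {m : ℕ → ℕ} (hm : Represents K idx x (T k) i m) (y : List ℕ) :
    ∃ m', Represents K idx x (T (n + 1)) 0 m' ∧
      Reaches P ((b.size + 7) * (i + 1)) ⟨p, m, y⟩ ⟨q, m', y⟩ := by
  obtain ⟨h0, h1, h2, h3, h4, h5, h6, -⟩ := id hP
  have hK0 := hK.2.2
  obtain rfl : i = n - k := by omega
  have hm₁ := hT k m (by omega) hm
  have hstart := b.reaches hb m y
  generalize b.sem m = m₁ at hm₁ hstart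
  let m₂ := Function.update m₁ 0 (K * (n - k))
  have hm₂ : Represents K idx x (T (k + 1)) (n - k) m₂ :=
    hm₁.congr fun a ha _ _ => Function.update_of_ne ha _ _
  have htest : Reaches P 2 ⟨p + b.size, m₁, y⟩ ⟨p + b.size + 1 + 1, m₂, y⟩ := by
    refine .head h0 (.head h1 ?_)
    have he : exec (exec ⟨p + b.size, m₁, y⟩ (.load (.at (.reg 1)))) (.sub (.lit 4)) =
        ⟨p + b.size + 1 + 1, m₂, y⟩ := by
      simp [exec, Operand.value, Addr.target, m₂, hm₁.1]
    rw [he]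
    exact .refl P _
  obtain hi | ⟨j, hj⟩ : n - k = 0 ∨ ∃ j, n - k = j + 1 := by
    cases n - k with
    | zero => exact Or.inl rfl
    | succ j => exact Or.inr ⟨j, rfl⟩
  · obtain rfl : k = n := by omega
    have hend : Reaches P 1 ⟨p + b.size + 1 + 1, m₂, y⟩ ⟨q, m₂, y⟩ := by
      refine .head h2 ?_
      have he : m₂ 0 = 0 := by simp [m₂]
      simp only [exec, he, if_true]
      exact .refl P _
    rw [hi] at hm₂ ⊢
    exact ⟨m₂, hm₂, ((hstart.trans htest).trans hend).mono (by omega)⟩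
  · have hne : m₂ 0 ≠ 0 := by simp [m₂, hj, hK0.ne']
    let m₃ := Function.update (Function.update m₂ 0 (m₂ 1 - K)) 1 (m₂ 1 - K)
    have hm₃ : Represents K idx x (T (k + 1)) j m₃ := by
      refine ⟨?_, fun l => ?_, fun l c => ?_⟩
      · simp only [m₃, Function.update_self, hm₂.1, hj, Nat.mul_succ]
        omega
      · rw [← hm₂.2.1]
        simp only [m₃]
        rw [Function.update_of_ne (by omega), Function.update_of_ne (by omega)]
      · rw [← hm₂.2.2]
        simp only [m₃]
        rw [Function.update_of_ne (by omega), Function.update_of_ne (by omega)]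
    have hloop : Reaches P 5 ⟨p + b.size + 1 + 1, m₂, y⟩ ⟨p, m₃, y⟩ := by
      refine .head h2 ?_
      simp only [exec, hne, if_false]
      refine .head h3 (.head h4 (.head h5 (.head h6 ?_)))
      have he : exec (exec (exec (exec ⟨p + b.size + 1 + 1 + 1, m₂, y⟩ (.load (.at (.reg 1))))
          (.sub (.lit K))) (.store (.reg 1))) (.jump p) = ⟨p, m₃, y⟩ := by
        simp [exec, Operand.value, Addr.target, m₃]
      rw [he]
      exact .refl P _
    obtain ⟨m', hm', h⟩ := reaches_treat_rows hK hb hP hT (i := j) (k := k + 1) (by omega) hm₃ y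
    refine ⟨m', hm', ((hstart.trans (htest.trans hloop)).trans h).mono ?_⟩
    rw [hj]
    exact le_of_eq (by ring)
termination_by i

theorem rowProgram_reaches {P : Program} {K : ℕ} {b d : Block} (hPbd : P = rowProgram K b d)
    {idx : C → ℕ} (hK : Layout K idx) {x : List ℕ} (hx : 0 ∉ x) {T : ℕ → Table C}
    (hT₀ : T 0 = 0)
    (hT : ∀ k m, k ≤ x.length → Represents K idx x (T k) (x.length - k) m →
      Represents K idx x (T (k + 1)) (x.length - k) (b.sem m)) :
    ∃ m s, Represents K idx x (T (x.length + 1)) 0 m ∧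
      Reaches P ((b.size + 14 + d.size) * (x.length + 1)) ⟨0, fun _ => 0, x⟩ s ∧
      P[s.pc]? = some (if d.sem m 0 = 0 then .reject else .accept) := by
  have hP := placed_self P
  nth_rewrite 2 [hPbd] at hP
  simp only [rowProgram, placed_append, Block.length_compile, List.length_cons, List.length_nil,
    Nat.zero_add, Nat.reduceAdd] at hP
  obtain ⟨⟨h0, h1, hread⟩, hb, hrows, hd, hj, ha, hr, -⟩ := hP
  let m₀ := Function.update (Function.update (fun _ => 0) 0 4) 1 4
  have hm₀ : Represents K idx (x.take 0) (0 : Table C) 0 m₀ := by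
    refine ⟨rfl, fun j => ?_, fun j c => ?_⟩ <;>
      simp only [m₀] <;> rw [Function.update_of_ne (by omega), Function.update_of_ne (by omega)] <;>
      rfl
  have hstart : Reaches P 2 ⟨0, fun _ => 0, x⟩ ⟨2, m₀, x.drop 0⟩ :=
    .head h0 (.head h1 (.refl P _))
  obtain ⟨m₁, y, hm₁, h₁⟩ := reaches_read_input hK hread hx (Nat.zero_add _).symm hm₀
  rw [← hT₀] at hm₁
  obtain ⟨m, hm, h₂⟩ := reaches_treat_rows hK hb hrows hT (Nat.zero_add _) hm₁ y
  have h₃ := d.reaches hd m y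
  have h := ((hstart.trans h₁).trans h₂).trans h₃
  -- Reading and treating rows contribute `7` each per row, hence `14`; the constants `2 + 3 + 1`
  -- fit into the surplus `7`, as there is one row more than there are letters.
  have hle : 2 + (7 * x.length + 3) + (b.size + 7) * (x.length + 1) + d.size + 1 ≤
      (b.size + 14 + d.size) * (x.length + 1) := by
    nlinarith [Nat.zero_le (d.size * x.length)]
  by_cases hz : d.sem m 0 = 0
  · refine ⟨m, _, hm, (h.trans (.single (s := ⟨9 + b.size + 7 + d.size, d.sem m, y⟩) hj)).mono hle,
      ?_⟩
    simp only [exec, hz, if_true]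
    exact hr
  · refine ⟨m, _, hm, (h.trans (.single (s := ⟨9 + b.size + 7 + d.size, d.sem m, y⟩) hj)).mono hle,
      ?_⟩
    simp only [exec, hz, if_false]
    exact ha

theorem exists_decidesInLinearTime [Finite A] {code : A → ℕ}
    (hcode : Function.Injective code) (hpos : ∀ a, code a ≠ 0) {L : Language A}
    (hL : PointerRecognizable L) : ∃ P : Program, DecidesInLinearTime code P L := by
  obtain ⟨C, hC, R, Φ, hR, hL⟩ := hL
  -- There are finitely many rules because both the alphabet, which occurs in the guards, and the
  -- set of cells are finite.
  obtain ⟨l, hl⟩ : ∃ l : List (PointerRule A C), ∀ r, r ∈ l ↔ r ∈ R :=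
    ⟨(Set.toFinite R).toFinset.toList, by simp⟩
  obtain ⟨cells, hcells⟩ : ∃ l : List C, ∀ c, c ∈ l :=
    ⟨(Set.toFinite (Set.univ : Set C)).toFinset.toList, by simp⟩
  let idx : C → ℕ := fun c => Finite.equivFin C c
  -- One register of the row for the letter and one for each cell.
  let K := Nat.card C + 1
  have hK : Layout K idx := ⟨Fin.val_injective.comp (Finite.equivFin C).injective, fun c => by
    have := (Finite.equivFin C c).isLt
    simp only [K, idx]
    omega, Nat.succ_pos _⟩
  let b := rowBlock code K idx l (Nat.card C + 1)
  let d := decisionBlock idx Φ cells ∅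
  refine ⟨rowProgram K b d, decidesInLinearTime_of_reaches (rowProgram_literalBound K b d)
    (b.size + 14 + d.size) fun w => ?_⟩
  obtain ⟨m, s, hm, hs, hpc⟩ := rowProgram_reaches (d := d) rfl hK (x := w.map code)
    (fun h => by obtain ⟨a, -, ha⟩ := List.mem_map.1 h; exact hpos a ha)
    (T := tabulate l (Nat.card C + 1) w) rfl (fun k m hk hm => by
      rw [List.length_map] at hm ⊢
      exact rowBlock_spec hcode hpos hK l _ (Nat.sub_le _ _) hm)
  rw [List.length_map] at hm hs
  have hiff : d.sem m 0 ≠ 0 ↔ w ∈ L := by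
    rw [decisionBlock_spec hm, hL]
    refine iff_of_eq (congrArg (fun s => s ∈ Φ) (Set.ext fun c => ?_))
    simp only [Set.empty_union, Set.mem_ofPred_eq, hcells, true_and]
    have hiff : ∀ j, tabulate l (Nat.card C + 1) w (w.length + 1) 0 c = j + 1 ↔
        Derives R w 0 c j := fun j => by
      rw [tabulate_eq_iff hR hl le_rfl]
      exact and_iff_right (by omega)
    simp only [← hiff]
    exact ⟨Nat.exists_eq_succ_of_ne_zero, fun ⟨j, hj⟩ => hj ▸ j.succ_ne_zero⟩
  refine ⟨s, hs, fun hw => ?_, fun hw => ?_⟩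
  · rw [hpc, if_neg (hiff.2 hw)]
  · rw [hpc, if_pos (not_not.1 (mt hiff.1 hw))]

end RAM

theorem mainTheorem5 {A : Type*} [Finite A] (code : A → ℕ)
    (hcode : Function.Injective code) (hpos : ∀ a, code a ≠ 0)
    (L : Language A) (hL : BoolClosure (RegClosure (DCFL A)) L) :
    ∃ P : RAM.Program, RAM.DecidesInLinearTime code P L :=
  RAM.exists_decidesInLinearTime hcode hpos
    (.of_boolClosure (fun _ => PointerRecognizable.of_regClosure) hL)
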